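/- We work in many-sorted continuous logic: the metric of each sort is bounded, function and relation symbols come with moduli of uniform continuity, relation symbols take values in bounded intervals, formulas are built from atomic formulas with all uniformly continuous connectives $\mathbb R^n\to\mathbb R$ and the quantifiers $\inf$ and $\sup$, and a definable predicate over $A$ is a uniform limit of $L(A)$-formulas. Let $\kappa$ be an uncountable cardinal and $\mathcal U$ a $\kappa$-saturated metric structure. A set or tuple is *small* if it has cardinality $<\kappa$; a *small model* is a small elementary substructure of $\mathcal U$. Let $M$ be a small model and let $G\subseteq \mathcal U^{\sigma}$ (a finite product of sorts) be a group definable over $M$, i.e. $G$ is closed, $\operatorname{dist}(x,G)$ is a definable predicate over $M$, and $d(x\cdot y,z)$ is, on $G$, given by a definable predicate over $M$. *Predicates and types.* Predicates on $G$ (over $A$) are restrictions to $G$ of definable predicates (over $A$); when no parameter set is named, all parameters from $\mathcal U$ are allowed. A complete type over $D$ on $G$ is a maximal consistent (that is, approximately finitely satisfiable in $G$) set of predicates on $G$ over $D$, each predicate $P$ being read as the condition $P=0$; a global type is a complete type over $\mathcal U$. For $g\in G$ put $(g\cdot P)(x)=P(g^{-1}x)$, and let $g\cdot p$ be the set of predicates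 $P$ on $G$ such that $P(gx)\in p$. For tuples, $a\equiv_A a'$ means that $a,a'$ have the same type over $A$. *Forking.* A set $\pi$ of predicates on $G$ divides over $C$ if there are a set $\Pi(x,y)$ of definable predicates over $C$ (with $y$ a small tuple of variables) and a $C$-indiscernible sequence $(b_i)_{i<\omega}$ with $\Pi(x,b_0)\subseteq \pi$ such that $\bigcup_i\Pi(x,b_i)$ is not satisfiable in $G$. It forks over $C$ if there is a set $D$ containing $C$ and the parameters of $\pi$ such that every complete type over $D$ on $G$ extending $\pi$ divides over $C$. A global type $p$ is *$f$-generic* if there is a small model $M_0$, over which $G$ is defined, such that no translate $g\cdot p$ ($g\in G$) forks over $M_0$. *Ideals.* An ideal is a set $I$ of positive (that is, $\geq 0$ on $G$) predicates on $G$ such that: if $P\in I$ and $Q\ge P$ is a predicate then $Q\in I$; if $P,Q\in I$ then $PQ\in I$; and every constant $\lambda>0$ is in $I$. It is an *$S_1$-ideal over $M$* if it is $M$-invariant (for every definable predicate $P(x,y)$ over $M$, if $P(x,a)\in I$ and $a\equiv_M a'$, then $P(x,a')\in I$) and, for every $M$-indiscernible sequence of positive predicates $P_i=P(x,b_i)$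 on $G$ (with $P(x,y)$ a definable predicate over $M$ and $(b_i)_{i<\omega}$ an $M$-indiscernible sequence), if $P_i+P_j\in I$ for all $i\ne j$ then $P_i\in I$ for all $i$. The ideal is translation invariant if $g\cdot P\in I$ for all $P\in I$, $g\in G$. A global type $p$ is *$I$-wide* if $p\cap I=\emptyset$. *Means.* A mean is a positive linear functional $\mathfrak m$ on the predicates on $G$ with $\mathfrak m(1)=1$. It is $G$-invariant if $\mathfrak m(g\cdot P)=\mathfrak m(P)$, and $M$-invariant if $\mathfrak m(P(x,a))=\mathfrak m(P(x,a'))$ for all definable predicates $P(x,y)$ over $M$ and all $a\equiv_M a'$. ($G$ is definably amenable if a $G$-invariant mean exists.) A positive predicate $P$ is *small* for $\mathfrak m$ if $\lim_{\lambda\to\infty}\mathfrak m(\min(\lambda P,1))=1$. **Theorem.** 1. If $I$ is a translation-invariant $S_1$-ideal over $M$, then every $I$-wide global type on $G$ is $f$-generic. 2. If $\mathfrak m$ is a $G$-invariant and $M$-invariant mean and $I$ is the set of predicates on $G$ that are small for $\mathfrak m$, then every $I$-wide global type on $G$ is $f$-generic. -/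

import Mathlib

open Filter Topology Cardinal

universe u w w'

/-! ### Continuous logic: languages, structures, formulas -/

/-- A many-sorted language for metric structures. Every sort has a bound for its metric, every
function and relation symbol has a modulus of uniform continuity in each of its arguments, and
every relation symbol has a bounded interval of values. -/
structure MetricLanguage where
  Sorts : Type u
  diam : Sorts → ℝ
  diam_pos : ∀ s, 0 < diam s
  Func : Type u
  funArity : Func → ℕ
  funDom : ∀ f, Fin (funArity f) → Sorts
  funCod : Func → Sorts
  funMod : ∀ f, Fin (funArity f) → ℝ → ℝ
  funMod_pos : ∀ f i ε, 0 < ε → 0 < funMod f i ε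
  Rel : Type u
  relArity : Rel → ℕ
  relDom : ∀ R, Fin (relArity R) → Sorts
  relLo : Rel → ℝ
  relHi : Rel → ℝ
  relMod : ∀ R, Fin (relArity R) → ℝ → ℝ
  relMod_pos : ∀ R i ε, 0 < ε → 0 < relMod R i ε

/-- An `L`-structure on a family of metric spaces indexed by the sorts. -/
class MetricStructure (L : MetricLanguage.{u}) (U : L.Sorts → Type u)
    [∀ s, MetricSpace (U s)] where
  nonempty : ∀ s, Nonempty (U s)
  dist_le : ∀ s (x y : U s), dist x y ≤ L.diam s
  funMap : ∀ f, (∀ i, U (L.funDom f i)) → U (L.funCod f)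
  relMap : ∀ R, (∀ i, U (L.relDom R i)) → ℝ
  funMap_unif : ∀ f (ε : ℝ), 0 < ε → ∀ x y : ∀ i, U (L.funDom f i),
    (∀ i, dist (x i) (y i) < L.funMod f i ε) → dist (funMap f x) (funMap f y) ≤ ε
  relMap_mem : ∀ R x, relMap R x ∈ Set.Icc (L.relLo R) (L.relHi R)
  relMap_unif : ∀ R (ε : ℝ), 0 < ε → ∀ x y : ∀ i, U (L.relDom R i),
    (∀ i, dist (x i) (y i) < L.relMod R i ε) → |relMap R x - relMap R y| ≤ ε

namespace ContLogic

/-- Terms in the free variables `a : α` (of sort `σ a`) and a list `Γ` of variables that are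
bound by surrounding quantifiers. -/
inductive Term (L : MetricLanguage.{u}) {α : Type w} (σ : α → L.Sorts) (Γ : List L.Sorts) :
    L.Sorts → Type (max u w)
  | free (a : α) : Term L σ Γ (σ a)
  | bound (i : Fin Γ.length) : Term L σ Γ (Γ.get i)
  | app (f : L.Func) (ts : ∀ i, Term L σ Γ (L.funDom f i)) : Term L σ Γ (L.funCod f)

/-- Formulas of continuous logic; the connectives are all uniformly continuous functions
`ℝ ^ n → ℝ`, the quantifiers are `inf` and `sup`. -/
inductive Formula (L : MetricLanguage.{u}) {α : Type w} (σ : α → L.Sorts) :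
    List L.Sorts → Type (max u w)
  | metric {Γ : List L.Sorts} (s : L.Sorts) (t₁ t₂ : Term L σ Γ s) : Formula L σ Γ
  | rel {Γ : List L.Sorts} (R : L.Rel) (ts : ∀ i, Term L σ Γ (L.relDom R i)) : Formula L σ Γ
  | conn {Γ : List L.Sorts} (n : ℕ) (c : (Fin n → ℝ) → ℝ) (hc : UniformContinuous c)
      (φs : Fin n → Formula L σ Γ) : Formula L σ Γ
  | inf {Γ : List L.Sorts} (s : L.Sorts) (φ : Formula L σ (s :: Γ)) : Formula L σ Γ
  | sup {Γ : List L.Sorts} (s : L.Sorts) (φ : Formula L σ (s :: Γ)) : Formula L σ Γ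

section Semantics

variable {L : MetricLanguage.{u}} (U : L.Sorts → Type u) [∀ s, MetricSpace (U s)]
  [MetricStructure L U]

/-- The value of a term under an assignment `v` of the free and `e` of the bound variables. -/
def Term.eval {α : Type w} {σ : α → L.Sorts} {Γ : List L.Sorts} (v : ∀ a, U (σ a))
    (e : ∀ i : Fin Γ.length, U (Γ.get i)) : ∀ {s : L.Sorts}, Term L σ Γ s → U s
  | _, .free a => v a
  | _, .bound i => e i
  | _, .app f ts => MetricStructure.funMap f fun i => (ts i).eval v e

/-- The value of a formula under an assignment `v` of the free and `e` of the bound variables. -/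
noncomputable def Formula.eval {α : Type w} {σ : α → L.Sorts} (v : ∀ a, U (σ a)) :
    ∀ {Γ : List L.Sorts}, Formula L σ Γ → (∀ i : Fin Γ.length, U (Γ.get i)) → ℝ
  | _, .metric _ t₁ t₂, e => dist (t₁.eval U v e) (t₂.eval U v e)
  | _, .rel R ts, e => MetricStructure.relMap (L := L) (U := U) R fun i => (ts i).eval U v e
  | _, .conn _ c _ φs, e => c fun i => (φs i).eval v e
  | Γ, .inf s φ, e => ⨅ x : U s, φ.eval v (Fin.cons (α := fun i => U ((s :: Γ).get i)) x e)
  | Γ, .sup s φ, e => ⨆ x : U s, φ.eval v (Fin.cons (α := fun i => U ((s :: Γ).get i)) x e)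

/-- The value of a formula without variables bound from outside. -/
noncomputable def Formula.val {α : Type w} {σ : α → L.Sorts} (φ : Formula L σ [])
    (v : ∀ a, U (σ a)) : ℝ :=
  φ.eval U v fun i => i.elim0

variable {U}

/-! ### Substructures and models -/

/-- The structure induced on a nonempty family of subsets closed under the function symbols. -/
@[reducible] def induced (M : ∀ s, Set (U s)) (hne : ∀ s, (M s).Nonempty)
    (hcl : ∀ (f : L.Func) (x : ∀ i, U (L.funDom f i)), (∀ i, x i ∈ M (L.funDom f i)) →
      MetricStructure.funMap f x ∈ M (L.funCod f)) :
    MetricStructure L fun s => ↥(M s) where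
  nonempty s := (hne s).to_subtype
  dist_le s x y := MetricStructure.dist_le s (x : U s) (y : U s)
  funMap f x := ⟨MetricStructure.funMap f fun i => (x i : U (L.funDom f i)),
    hcl f _ fun i => (x i).2⟩
  relMap R x := MetricStructure.relMap (L := L) (U := U) R fun i => (x i : U (L.relDom R i))
  funMap_unif f ε hε _ _ h := MetricStructure.funMap_unif (L := L) (U := U) f ε hε _ _ h
  relMap_mem R _ := MetricStructure.relMap_mem (L := L) (U := U) R _
  relMap_unif R ε hε _ _ h := MetricStructure.relMap_unif (L := L) (U := U) R ε hε _ _ h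

/-- `M` is (the universe of) an elementary substructure of `U`. -/
def IsElementary (M : ∀ s, Set (U s)) : Prop :=
  ∃ (hne : ∀ s, (M s).Nonempty)
    (hcl : ∀ (f : L.Func) (x : ∀ i, U (L.funDom f i)), (∀ i, x i ∈ M (L.funDom f i)) →
      MetricStructure.funMap f x ∈ M (L.funCod f)),
    ∀ (n : ℕ) (σ : Fin n → L.Sorts) (φ : Formula L σ []) (v : ∀ i, ↥(M (σ i))),
      @Formula.val L (fun s => ↥(M s)) _ (induced M hne hcl) _ σ φ v =
        φ.val U fun i => (v i : U (σ i))

/-- A small model: an elementary substructure with fewer than `κ` elements. -/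
def IsSmallModel (κ : Cardinal.{u}) (M : ∀ s, Set (U s)) : Prop :=
  IsElementary M ∧ #(Σ s, ↥(M s)) < κ

/-! ### Parameters, definable predicates, types of tuples, saturation -/

/-- Concatenation of tuples. -/
def glue {α : Type w} {β : Type w'} {σ : α → L.Sorts} {τ : β → L.Sorts}
    (x : ∀ a, U (σ a)) (y : ∀ b, U (τ b)) : ∀ z : α ⊕ β, U (Sum.elim σ τ z)
  | .inl a => x a
  | .inr b => y b

/-- `L(A)`-formulas in the free variables `σ`: the elements of `A` are used as additional free
variables, to be interpreted by themselves. -/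
abbrev PFormula (A : ∀ s, Set (U s)) {α : Type w} (σ : α → L.Sorts) :=
  Formula L (Sum.elim σ (Sigma.fst : (Σ s, ↥(A s)) → L.Sorts)) []

/-- The value of an `L(A)`-formula. -/
noncomputable def PFormula.val {A : ∀ s, Set (U s)} {α : Type w} {σ : α → L.Sorts}
    (φ : PFormula A σ) (x : ∀ a, U (σ a)) : ℝ :=
  Formula.val U φ (glue x fun c => (c.2 : U c.1))

/-- `P` is a definable predicate with parameters in `A`: a uniform limit of `L(A)`-formulas. -/
def IsDefPred (A : ∀ s, Set (U s)) {α : Type w} (σ : α → L.Sorts)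
    (P : (∀ a, U (σ a)) → ℝ) : Prop :=
  ∀ ε : ℝ, 0 < ε → ∃ φ : PFormula A σ, ∀ x, |φ.val x - P x| ≤ ε

/-- `a ≡_A a'`: the tuples `a` and `a'` have the same type over `A`. -/
def SameType (A : ∀ s, Set (U s)) {β : Type w} {τ : β → L.Sorts} (a a' : ∀ j, U (τ j)) : Prop :=
  ∀ φ : PFormula A τ, φ.val a = φ.val a'

/-- `(b i)_{i < ω}` is an `A`-indiscernible sequence of tuples. -/
def Indiscernible (A : ∀ s, Set (U s)) {β : Type w} {τ : β → L.Sorts}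
    (b : ℕ → ∀ j, U (τ j)) : Prop :=
  ∀ (n : ℕ) (f g : Fin n ↪o ℕ),
    SameType A (τ := fun z : Fin n × β => τ z.2)
      (fun z => b (f z.1) z.2) (fun z => b (g z.1) z.2)

variable (U) in
/-- `U` is `κ`-saturated: a set of conditions `φ = 0` in finitely many variables, with fewer than
`κ` parameters, that is approximately finitely satisfiable in `U` is satisfied in `U`. -/
def IsSaturated (κ : Cardinal.{u}) : Prop :=
  ∀ A : ∀ s, Set (U s), #(Σ s, ↥(A s)) < κ → ∀ (n : ℕ) (σ : Fin n → L.Sorts)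
    (Φ : Set (PFormula A σ)),
    (∀ F : Finset (PFormula A σ), (F : Set (PFormula A σ)) ⊆ Φ → ∀ ε : ℝ, 0 < ε →
      ∃ x : ∀ i, U (σ i), ∀ φ ∈ F, |φ.val x| ≤ ε) →
    ∃ x : ∀ i, U (σ i), ∀ φ ∈ Φ, φ.val x = 0

variable (U) in
/-- The set of all elements of `U`, as a parameter set. -/
def allParams : ∀ s, Set (U s) := fun _ => Set.univ

/-! ### Definable groups and predicates on them -/

/-- `G ⊆ U ^ σ` is a group definable over `A`: `G` is closed, the distance to `G` is a definable
predicate over `A`, and `d (x * y, z)` is on `G` given by a definable predicate over `A`. -/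
structure IsDefinableGroup (A : ∀ s, Set (U s)) {n : ℕ} {σ : Fin n → L.Sorts}
    (G : Set (∀ i, U (σ i))) [Group G] : Prop where
  closed : IsClosed G
  dist_def : IsDefPred A σ fun x => Metric.infDist x G
  mul_def : ∃ Q : (∀ z, U (Sum.elim σ (Sum.elim σ σ) z)) → ℝ,
    IsDefPred A (Sum.elim σ (Sum.elim σ σ)) Q ∧
      ∀ x y z : G, Q (glue x.1 (glue y.1 z.1)) = dist (x * y) z

section OnGroup

variable {n : ℕ} {σ : Fin n → L.Sorts} (G : Set (∀ i, U (σ i)))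

/-- The predicates on `G` with parameters in `A`: restrictions to `G` of definable predicates. -/
def Pred (A : ∀ s, Set (U s)) : Set (G → ℝ) :=
  {P | ∃ Q : (∀ i, U (σ i)) → ℝ, IsDefPred A σ Q ∧ ∀ x : G, P x = Q x.1}

variable {G}

/-- The predicate `R(x, b)` on `G` obtained from `R(x, y)` by substituting the tuple `b`. -/
def inst {β : Type w} {τ : β → L.Sorts} (R : (∀ z, U (Sum.elim σ τ z)) → ℝ)
    (b : ∀ j, U (τ j)) : G → ℝ :=
  fun x => R (glue x.1 b)

/-! ### Types on `G`, dividing, forking, `f`-generic types -/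

/-- A set of predicates on `G`, read as the set of conditions `P = 0`, is consistent. -/
def Consistent (π : Set (G → ℝ)) : Prop :=
  ∀ F : Finset (G → ℝ), (F : Set (G → ℝ)) ⊆ π → ∀ ε : ℝ, 0 < ε →
    ∃ x : G, ∀ P ∈ F, |P x| ≤ ε

/-- A complete type over `D`, concentrated on `G`: a maximal consistent set of predicates on `G`
with parameters in `D`. -/
def IsCompleteType (D : ∀ s, Set (U s)) (q : Set (G → ℝ)) : Prop :=
  Maximal (fun π => π ⊆ Pred G D ∧ Consistent π) q

/-- A global type on `G`: a complete type over all of `U`. -/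
def IsGlobalType (p : Set (G → ℝ)) : Prop :=
  IsCompleteType (allParams U) p

/-- `π` divides over `C`: it contains `Π(x, b₀)` for some set `Π(x, y)` of predicates over `C` and
some small tuple `b₀` which starts a `C`-indiscernible sequence `(b i)` such that the union of the
`Π(x, b i)` is not satisfiable. -/
def Divides (κ : Cardinal.{u}) (C : ∀ s, Set (U s)) (π : Set (G → ℝ)) : Prop :=
  ∃ (β : Type u) (τ : β → L.Sorts) (b : ℕ → ∀ j, U (τ j))
    (Φ : Set ((∀ z, U (Sum.elim σ τ z)) → ℝ)),
    #β < κ ∧ Indiscernible C b ∧ (∀ R ∈ Φ, IsDefPred C (Sum.elim σ τ) R) ∧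
    (∀ R ∈ Φ, (inst R (b 0) : G → ℝ) ∈ π) ∧
    ¬ ∃ x : G, ∀ i, ∀ R ∈ Φ, inst R (b i) x = 0

/-- `π` forks over `C`: for some set `D` containing `C` and the parameters of `π`, every complete
type over `D` extending `π` divides over `C`. -/
def Forks (κ : Cardinal.{u}) (C : ∀ s, Set (U s)) (π : Set (G → ℝ)) : Prop :=
  ∃ D : ∀ s, Set (U s), (∀ s, C s ⊆ D s) ∧ π ⊆ Pred G D ∧
    ∀ q : Set (G → ℝ), IsCompleteType D q → π ⊆ q → Divides κ C q

variable [Group G]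

/-- The translate `g · P`, that is `(g · P)(x) = P(g⁻¹ x)`. -/
def translate (g : G) (P : G → ℝ) : G → ℝ := fun x => P (g⁻¹ * x)

/-- The translate `g · p` of a global type: the type of `g · a` for a realization `a` of `p`. -/
def translateType (g : G) (p : Set (G → ℝ)) : Set (G → ℝ) :=
  {P | P ∈ Pred G (allParams U) ∧ (fun x => P (g * x)) ∈ p}

/-- `p` is `f`-generic: there is a small model (over which the group is defined) over which no
translate of `p` (in particular not `p` itself) forks. -/
def IsFGeneric (κ : Cardinal.{u}) (p : Set (G → ℝ)) : Prop :=
  ∃ M₀ : ∀ s, Set (U s), IsSmallModel κ M₀ ∧ IsDefinableGroup M₀ G ∧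
    ∀ g : G, ¬ Forks κ M₀ (translateType g p)

/-! ### Ideals of positive predicates -/

/-- The positive predicates on `G`, with arbitrary parameters. -/
def PosPred (G : Set (∀ i, U (σ i))) : Set (G → ℝ) :=
  {P | P ∈ Pred G (allParams U) ∧ ∀ x, 0 ≤ P x}

/-- `I` is an ideal of positive predicates on `G`. -/
structure IsIdeal (I : Set (G → ℝ)) : Prop where
  subset : I ⊆ PosPred G
  up : ∀ P ∈ I, ∀ Q ∈ PosPred G, (∀ x, P x ≤ Q x) → Q ∈ I
  mul : ∀ P ∈ I, ∀ Q ∈ I, P * Q ∈ I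
  const : ∀ c : ℝ, 0 < c → (fun _ => c) ∈ I

/-- `I` is `A`-invariant: if `P(x, a) ∈ I` and `a ≡_A a'` then `P(x, a') ∈ I`. -/
def IsInvariantOver (A : ∀ s, Set (U s)) (I : Set (G → ℝ)) : Prop :=
  ∀ (β : Type u) (τ : β → L.Sorts) (a a' : ∀ j, U (τ j)), SameType A a a' →
    ∀ R : (∀ z, U (Sum.elim σ τ z)) → ℝ, IsDefPred A (Sum.elim σ τ) R →
      inst R a ∈ I → inst R a' ∈ I

/-- `I` is an `S₁`-ideal over `A`: an `A`-invariant ideal such that for every `A`-indiscernible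
sequence `P i = R(x, b i)` of positive predicates, if `P i + P j ∈ I` for all `i ≠ j`, then
all `P i` are in `I`. -/
structure IsS1Ideal (A : ∀ s, Set (U s)) (I : Set (G → ℝ)) : Prop where
  ideal : IsIdeal I
  invariant : IsInvariantOver A I
  s1 : ∀ (β : Type u) (τ : β → L.Sorts) (b : ℕ → ∀ j, U (τ j))
    (R : (∀ z, U (Sum.elim σ τ z)) → ℝ),
    Indiscernible A b → IsDefPred A (Sum.elim σ τ) R → (∀ i, inst R (b i) ∈ PosPred G) →
    (∀ i j, i ≠ j → (inst R (b i) + inst R (b j) : G → ℝ) ∈ I) → ∀ i, inst R (b i) ∈ I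

/-- `I` is invariant under translation by elements of the group. -/
def IsTranslationInvariant (I : Set (G → ℝ)) : Prop :=
  ∀ g : G, ∀ P ∈ I, translate g P ∈ I

/-- `p` is `I`-wide. -/
def IsWide (I p : Set (G → ℝ)) : Prop := p ∩ I = ∅

/-! ### Means and small predicates -/

/-- `m` is a mean on the predicates on `G` with arbitrary parameters: a normalized positive linear
functional. (The values of `m` at functions that are not predicates are irrelevant.) -/
structure IsMean (m : (G → ℝ) → ℝ) : Prop where
  add : ∀ P ∈ Pred G (allParams U), ∀ Q ∈ Pred G (allParams U), m (P + Q) = m P + m Q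
  smul : ∀ c : ℝ, ∀ P ∈ Pred G (allParams U), m (c • P) = c * m P
  nonneg : ∀ P ∈ PosPred G, 0 ≤ m P
  one : m (fun _ => 1) = 1

/-- The mean is invariant under translation. (The group is definably amenable if such a mean
exists.) -/
def IsGroupInvariantMean (m : (G → ℝ) → ℝ) : Prop :=
  ∀ g : G, ∀ P ∈ Pred G (allParams U), m (translate g P) = m P

/-- The mean is `A`-invariant: `m (P(x, a)) = m (P(x, a'))` whenever `a ≡_A a'`. -/
def IsInvariantMeanOver (A : ∀ s, Set (U s)) (m : (G → ℝ) → ℝ) : Prop :=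
  ∀ (β : Type u) (τ : β → L.Sorts) (a a' : ∀ j, U (τ j)), SameType A a a' →
    ∀ R : (∀ z, U (Sum.elim σ τ z)) → ℝ, IsDefPred A (Sum.elim σ τ) R →
      m (inst R a) = m (inst R a')

/-- The set of small positive predicates: those with `m (min (c P) 1) → 1` for `c → ∞`. -/
def smallPreds (m : (G → ℝ) → ℝ) : Set (G → ℝ) :=
  {P | P ∈ PosPred G ∧ Tendsto (fun c : ℝ => m fun x => min (c * P x) 1) atTop (𝓝 1)}

end OnGroup

end Semantics

end ContLogic

open ContLogic

/-!
The proof takes the given model `M` itself as the small model over which no translate forks.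

*Part 1.* A translate of a wide global type is again a wide global type, so it suffices that a wide
global type `p` does not fork over `M` (`IsS1Ideal.not_forks`). Whatever the parameter set `D`, the
type `p` is its own completion over `D`, so it suffices that `p` does not divide over `M`
(`IsS1Ideal.not_divides`). If it divides, witnessed by `Π(x, y)` and an indiscernible sequence
`(b i)`, then saturation yields a finite part of `Π`, hence a single positive predicate `R(x, y)`,
the sum of the absolute values of its members, such that `R(x, b 0)` is in `p` and a finite sum of
the `R(x, b i)` is bounded below on the group by a positive constant
(`IsDefinableGroup.exists_pos_le_sum`). That sum is in the ideal. The `S₁`-property, applied to sums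
over dyadic blocks of the sequence, puts `R(x, b 0)` into the ideal
(`IsS1Ideal.inst_mem_of_sum_mem`), contradicting wideness.

*Part 2.* The small predicates of an invariant mean form a translation-invariant `S₁`-ideal
(`IsMean.isS1Ideal_smallPreds`), so that part 1 applies. For the `S₁`-property put
`Q i = 1 - min (c P i) 1`. All `Q i` have the same mean `q`, and
`Q i * Q j ≤ 1 - min ((c / 2) (P i + P j)) 1`, whose mean `η` tends to `0` as `c → ∞`. The second
moment of `Q 0 + ⋯ + Q (N - 1)` about its mean is nonnegative, which for `N → ∞` gives `q ^ 2 ≤ η`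
(`IsMean.sq_le_of_mul_le`), so `q → 0`.

Both parts need that definable predicates are closed under continuous connectives, substitution, and
infima over the group (`IsDefPred.comp`, `IsDefPred.subst`, `IsDefPred.iInf_mem`). The last gives
that translates of predicates are predicates (`IsDefinableGroup.translate_mem_pred`) and that
positivity on the group of `R(x, a)` depends on the type of `a` only
(`IsDefinableGroup.inst_mem_posPred`).
-/

namespace ContLogic

section Formulas

variable {L : MetricLanguage.{u}} {α : Type w} {σ : α → L.Sorts} {α' : Type w'} {σ' : α' → L.Sorts}

/-! ### Simultaneous substitution -/

/-- Weakening of a term by a new innermost bound variable. -/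
def Term.weaken {Γ : List L.Sorts} (r : L.Sorts) :
    ∀ {s : L.Sorts}, Term L σ Γ s → Term L σ (r :: Γ) s
  | _, .free a => .free a
  | _, .bound i => .bound (Γ := r :: Γ) i.succ
  | _, .app f ts => .app f fun i => (ts i).weaken r

/-- Simultaneous substitution for the free and the bound variables of a term. -/
def Term.subst {Γ Γ' : List L.Sorts} (f : ∀ a, Term L σ' Γ' (σ a))
    (g : ∀ i : Fin Γ.length, Term L σ' Γ' (Γ.get i)) :
    ∀ {s : L.Sorts}, Term L σ Γ s → Term L σ' Γ' s
  | _, .free a => f a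
  | _, .bound i => g i
  | _, .app h ts => .app h fun i => (ts i).subst f g

/-- A substitution for the bound variables, carried under one more quantifier. -/
def liftBound {Γ Γ' : List L.Sorts} (r : L.Sorts)
    (g : ∀ i : Fin Γ.length, Term L σ' Γ' (Γ.get i)) :
    ∀ i : Fin (r :: Γ).length, Term L σ' (r :: Γ') ((r :: Γ).get i) :=
  Fin.cases (motive := fun i => Term L σ' (r :: Γ') ((r :: Γ).get i))
    (.bound (Γ := r :: Γ') (0 : Fin (Γ'.length + 1))) fun i => (g i).weaken r

/-- Simultaneous substitution for the free and the outer bound variables of a formula. -/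
def Formula.subst : ∀ {Γ Γ' : List L.Sorts}, (∀ a, Term L σ' Γ' (σ a)) →
    (∀ i : Fin Γ.length, Term L σ' Γ' (Γ.get i)) → Formula L σ Γ → Formula L σ' Γ'
  | _, _, f, g, .metric s t₁ t₂ => .metric s (t₁.subst f g) (t₂.subst f g)
  | _, _, f, g, .rel R ts => .rel R fun i => (ts i).subst f g
  | _, _, f, g, .conn n c hc φs => .conn n c hc fun i => (φs i).subst f g
  | _, _, f, g, .inf s φ => .inf s (φ.subst (fun a => (f a).weaken s) (liftBound s g))
  | _, _, f, g, .sup s φ => .sup s (φ.subst (fun a => (f a).weaken s) (liftBound s g))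

variable (U : L.Sorts → Type u) [∀ s, MetricSpace (U s)] [MetricStructure L U]

theorem Term.eval_weaken (v : ∀ a, U (σ a)) {Γ : List L.Sorts} (r : L.Sorts)
    (e : ∀ i : Fin Γ.length, U (Γ.get i)) (x : U r) {s : L.Sorts} (t : Term L σ Γ s) :
    (t.weaken r).eval U v (Fin.cons (α := fun i => U ((r :: Γ).get i)) x e) = t.eval U v e := by
  induction t with
  | free a => rfl
  | bound i => rfl
  | app f ts ih => simp only [Term.weaken, Term.eval, ih]

theorem Term.eval_subst (v : ∀ a, U (σ' a)) {Γ Γ' : List L.Sorts}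
    (e : ∀ i : Fin Γ'.length, U (Γ'.get i)) (f : ∀ a, Term L σ' Γ' (σ a))
    (g : ∀ i : Fin Γ.length, Term L σ' Γ' (Γ.get i)) {s : L.Sorts} (t : Term L σ Γ s) :
    (t.subst f g).eval U v e =
      t.eval U (fun a => (f a).eval U v e) (fun i => (g i).eval U v e) := by
  induction t with
  | free a => rfl
  | bound i => rfl
  | app f ts ih => simp only [Term.subst, Term.eval, ih]

theorem eval_liftBound (v : ∀ a, U (σ' a)) {Γ Γ' : List L.Sorts} (r : L.Sorts)
    (e : ∀ i : Fin Γ'.length, U (Γ'.get i))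
    (g : ∀ i : Fin Γ.length, Term L σ' Γ' (Γ.get i)) (x : U r) :
    (fun i => (liftBound r g i).eval U v (Fin.cons (α := fun i => U ((r :: Γ').get i)) x e)) =
      Fin.cons (α := fun i => U ((r :: Γ).get i)) x (fun i => (g i).eval U v e) := by
  funext i
  refine Fin.cases ?_ (fun i => ?_) i
  · rfl
  · exact Term.eval_weaken U v r e x (g i)

theorem Formula.eval_subst (v : ∀ a, U (σ' a)) {Γ : List L.Sorts} (φ : Formula L σ Γ) :
    ∀ {Γ' : List L.Sorts} (e : ∀ i : Fin Γ'.length, U (Γ'.get i))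
    (f : ∀ a, Term L σ' Γ' (σ a)) (g : ∀ i : Fin Γ.length, Term L σ' Γ' (Γ.get i)),
    (φ.subst f g).eval U v e =
      φ.eval U (fun a => (f a).eval U v e) (fun i => (g i).eval U v e) := by
  induction φ with
  | metric s t₁ t₂ => intro Γ' e f g; simp only [Formula.subst, Formula.eval, Term.eval_subst]
  | rel R ts => intro Γ' e f g; simp only [Formula.subst, Formula.eval, Term.eval_subst]
  | conn n c hc φs ih => intro Γ' e f g; simp only [Formula.subst, Formula.eval, ih]
  | inf s φ ih =>
    intro Γ' e f g
    simp only [Formula.subst, Formula.eval, ih, Term.eval_weaken, eval_liftBound]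
  | sup s φ ih =>
    intro Γ' e f g
    simp only [Formula.subst, Formula.eval, ih, Term.eval_weaken, eval_liftBound]

/-! ### Formulas are bounded and uniformly continuous -/

theorem Formula.exists_bound {Γ : List L.Sorts} (φ : Formula L σ Γ) :
    ∃ B : ℝ, ∀ v e, |φ.eval U v e| ≤ B := by
  induction φ with
  | metric s t₁ t₂ =>
    refine ⟨L.diam s, fun v e => ?_⟩
    rw [Formula.eval, abs_of_nonneg dist_nonneg]
    exact MetricStructure.dist_le s _ _
  | rel R ts =>
    refine ⟨max |L.relLo R| |L.relHi R|, fun v e => ?_⟩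
    have h := MetricStructure.relMap_mem (L := L) (U := U) R (fun i => (ts i).eval U v e)
    exact abs_le_max_abs_abs h.1 h.2
  | conn n c hc φs ih =>
    choose B hB using ih
    have hK : IsCompact (Set.univ.pi fun i => Set.Icc (-B i) (B i)) :=
      isCompact_univ_pi fun i => isCompact_Icc
    obtain ⟨C, hC⟩ := (hK.image hc.continuous).isBounded.exists_norm_le
    refine ⟨C, fun v e => hC _ ⟨_, fun i _ => ?_, rfl⟩⟩
    exact abs_le.1 (hB i v e)
  | inf s φ ih =>
    obtain ⟨B, hB⟩ := ih
    have : Nonempty (U s) := MetricStructure.nonempty (L := L) s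
    refine ⟨B, fun v e => abs_le.2 ⟨le_ciInf fun x => (abs_le.1 (hB _ _)).1, ?_⟩⟩
    exact ciInf_le_of_le ⟨-B, by rintro _ ⟨x, rfl⟩; exact (abs_le.1 (hB _ _)).1⟩
      (Classical.arbitrary _) (abs_le.1 (hB _ _)).2
  | sup s φ ih =>
    obtain ⟨B, hB⟩ := ih
    have : Nonempty (U s) := MetricStructure.nonempty (L := L) s
    refine ⟨B, fun v e => abs_le.2 ⟨?_, ciSup_le fun x => (abs_le.1 (hB _ _)).2⟩⟩
    exact le_ciSup_of_le ⟨B, by rintro _ ⟨x, rfl⟩; exact (abs_le.1 (hB _ _)).2⟩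
      (Classical.arbitrary _) (abs_le.1 (hB _ _)).1

theorem exists_pos_forall_le {ι : Type*} [Finite ι] {δ : ι → ℝ} (h : ∀ i, 0 < δ i) :
    ∃ d : ℝ, 0 < d ∧ ∀ i, d ≤ δ i := by
  obtain ⟨⟨d, hd⟩, hle⟩ := Finite.exists_ge fun i => (⟨δ i, h i⟩ : Set.Ioi (0 : ℝ))
  exact ⟨d, hd, hle⟩

theorem Term.unif {Γ : List L.Sorts} {s : L.Sorts} (t : Term L σ Γ s) :
    ∀ ε : ℝ, 0 < ε → ∃ δ : ℝ, 0 < δ ∧ ∀ (v v' : ∀ a, U (σ a))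
      (e e' : ∀ i : Fin Γ.length, U (Γ.get i)), (∀ a, dist (v a) (v' a) < δ) →
      (∀ i, dist (e i) (e' i) < δ) → dist (t.eval U v e) (t.eval U v' e') < ε := by
  induction t with
  | free a => exact fun ε hε => ⟨ε, hε, fun v v' e e' h _ => h a⟩
  | bound i => exact fun ε hε => ⟨ε, hε, fun v v' e e' _ h => h i⟩
  | app f ts ih =>
    intro ε hε
    choose δ hδ h using fun i => ih i _ (L.funMod_pos f i (ε / 2) (by positivity))
    obtain ⟨d, hd, hle⟩ := exists_pos_forall_le hδ
    refine ⟨d, hd, fun v v' e e' h₁ h₂ => lt_of_le_of_lt ?_ (half_lt_self hε)⟩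
    exact MetricStructure.funMap_unif f (ε / 2) (by positivity) _ _ fun i =>
      h i v v' e e' (fun a => (h₁ a).trans_le (hle i)) (fun a => (h₂ a).trans_le (hle i))

theorem abs_ciInf_sub_ciInf_le {ι : Type*} [Nonempty ι] {f g : ι → ℝ} {ε : ℝ}
    (hf : BddBelow (Set.range f)) (hg : BddBelow (Set.range g)) (h : ∀ i, |f i - g i| ≤ ε) :
    |(⨅ i, f i) - ⨅ i, g i| ≤ ε := by
  rw [abs_le]
  constructor
  · have : (⨅ i, g i) - ε ≤ ⨅ i, f i :=
      le_ciInf fun i => by linarith [ciInf_le hg i, (abs_le.1 (h i)).1]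
    linarith
  · have : (⨅ i, f i) - ε ≤ ⨅ i, g i :=
      le_ciInf fun i => by linarith [ciInf_le hf i, (abs_le.1 (h i)).2]
    linarith

theorem abs_ciSup_sub_ciSup_le {ι : Type*} [Nonempty ι] {f g : ι → ℝ} {ε : ℝ}
    (hf : BddAbove (Set.range f)) (hg : BddAbove (Set.range g)) (h : ∀ i, |f i - g i| ≤ ε) :
    |(⨆ i, f i) - ⨆ i, g i| ≤ ε := by
  rw [abs_le]
  constructor
  · have : (⨆ i, g i) ≤ (⨆ i, f i) + ε :=
      ciSup_le fun i => by linarith [le_ciSup hf i, (abs_le.1 (h i)).1]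
    linarith
  · have : (⨆ i, f i) ≤ (⨆ i, g i) + ε :=
      ciSup_le fun i => by linarith [le_ciSup hg i, (abs_le.1 (h i)).2]
    linarith

/-- Formulas are uniformly continuous. The free variables may be infinite in number: closeness of
two assignments is measured in the supremum distance. -/
theorem Formula.unif {Γ : List L.Sorts} (φ : Formula L σ Γ) :
    ∀ ε : ℝ, 0 < ε → ∃ δ : ℝ, 0 < δ ∧ ∀ (v v' : ∀ a, U (σ a))
      (e e' : ∀ i : Fin Γ.length, U (Γ.get i)), (∀ a, dist (v a) (v' a) < δ) →
      (∀ i, dist (e i) (e' i) < δ) → |φ.eval U v e - φ.eval U v' e'| ≤ ε := by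
  induction φ with
  | metric s t₁ t₂ =>
    intro ε hε
    obtain ⟨d₁, hd₁, h₁⟩ := t₁.unif U (ε / 2) (by positivity)
    obtain ⟨d₂, hd₂, h₂⟩ := t₂.unif U (ε / 2) (by positivity)
    refine ⟨min d₁ d₂, lt_min hd₁ hd₂, fun v v' e e' hv he => ?_⟩
    have h₁ := h₁ v v' e e' (fun a => (hv a).trans_le (min_le_left _ _))
      (fun a => (he a).trans_le (min_le_left _ _))
    have h₂ := h₂ v v' e e' (fun a => (hv a).trans_le (min_le_right _ _))
      (fun a => (he a).trans_le (min_le_right _ _))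
    have := dist_dist_dist_le (t₁.eval U v e) (t₂.eval U v e) (t₁.eval U v' e') (t₂.eval U v' e')
    rw [Real.dist_eq] at this
    simp only [Formula.eval]
    linarith
  | rel R ts =>
    intro ε hε
    choose δ hδ h using fun i => (ts i).unif U _ (L.relMod_pos R i ε hε)
    obtain ⟨d, hd, hle⟩ := exists_pos_forall_le hδ
    refine ⟨d, hd, fun v v' e e' h₁ h₂ => ?_⟩
    exact MetricStructure.relMap_unif R ε hε _ _ fun i =>
      h i v v' e e' (fun a => (h₁ a).trans_le (hle i)) (fun a => (h₂ a).trans_le (hle i))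
  | conn n c hc φs ih =>
    intro ε hε
    obtain ⟨η, hη, hc⟩ := Metric.uniformContinuous_iff.1 hc ε hε
    choose δ hδ h using fun i => ih i (η / 2) (by positivity)
    obtain ⟨d, hd, hle⟩ := exists_pos_forall_le hδ
    refine ⟨d, hd, fun v v' e e' h₁ h₂ => ?_⟩
    refine (hc ((dist_pi_lt_iff hη).2 fun i => lt_of_le_of_lt ?_ (half_lt_self hη))).le
    exact h i v v' e e' (fun a => (h₁ a).trans_le (hle i)) (fun a => (h₂ a).trans_le (hle i))
  | inf s φ ih =>
    intro ε hε
    obtain ⟨B, hB⟩ := φ.exists_bound U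
    have : Nonempty (U s) := MetricStructure.nonempty (L := L) s
    obtain ⟨d, hd, h⟩ := ih ε hε
    refine ⟨d, hd, fun v v' e e' h₁ h₂ => abs_ciInf_sub_ciInf_le ?_ ?_ fun x => h _ _ _ _ h₁ ?_⟩
    · exact ⟨-B, by rintro _ ⟨x, rfl⟩; exact (abs_le.1 (hB _ _)).1⟩
    · exact ⟨-B, by rintro _ ⟨x, rfl⟩; exact (abs_le.1 (hB _ _)).1⟩
    · exact Fin.cases ((dist_self x).trans_lt hd) h₂
  | sup s φ ih =>
    intro ε hε
    obtain ⟨B, hB⟩ := φ.exists_bound U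
    have : Nonempty (U s) := MetricStructure.nonempty (L := L) s
    obtain ⟨d, hd, h⟩ := ih ε hε
    refine ⟨d, hd, fun v v' e e' h₁ h₂ => abs_ciSup_sub_ciSup_le ?_ ?_ fun x => h _ _ _ _ h₁ ?_⟩
    · exact ⟨B, by rintro _ ⟨x, rfl⟩; exact (abs_le.1 (hB _ _)).2⟩
    · exact ⟨B, by rintro _ ⟨x, rfl⟩; exact (abs_le.1 (hB _ _)).2⟩
    · exact Fin.cases ((dist_self x).trans_lt hd) h₂

/-- Quantification over all bound variables at once. -/
theorem Formula.exists_infAll {Γ : List L.Sorts} (φ : Formula L σ Γ) :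
    ∃ ψ : Formula L σ [], ∀ v, IsGLB (Set.range fun e => φ.eval U v e) (ψ.val U v) := by
  induction Γ with
  | nil =>
    refine ⟨φ, fun v => ?_⟩
    have : (Set.range fun e => φ.eval U v e) = {φ.val U v} := by
      ext y
      constructor
      · rintro ⟨e, rfl⟩
        exact congrArg (φ.eval U v) (funext fun i => i.elim0)
      · rintro rfl
        exact ⟨_, rfl⟩
    rw [this]
    exact isGLB_singleton
  | cons s Γ ih =>
    obtain ⟨ψ, hψ⟩ := ih (.inf s φ)
    obtain ⟨B, hB⟩ := φ.exists_bound U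
    have : Nonempty (U s) := MetricStructure.nonempty (L := L) s
    refine ⟨ψ, fun v => ⟨?_, fun y hy => (hψ v).2 ?_⟩⟩
    · rintro _ ⟨e, rfl⟩
      refine ((hψ v).1 ⟨fun i => e i.succ, rfl⟩).trans ?_
      refine ciInf_le_of_le ⟨-B, by rintro _ ⟨x, rfl⟩; exact (abs_le.1 (hB _ _)).1⟩ (e 0) ?_
      refine le_of_eq (congrArg (φ.eval U v) ?_)
      exact Fin.cons_self_tail (α := fun i => U ((s :: Γ).get i)) e
    · rintro _ ⟨e, rfl⟩
      exact le_ciInf fun x => hy ⟨_, rfl⟩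

end Formulas

section DefinablePredicates

variable {L : MetricLanguage.{u}} {U : L.Sorts → Type u} [∀ s, MetricSpace (U s)]
  [MetricStructure L U] {A A' : ∀ s, Set (U s)}

/-! ### Closure properties of definable predicates -/

theorem nonempty_tuple (U : L.Sorts → Type u) [∀ s, MetricSpace (U s)]
    [MetricStructure L U] {α : Type w} (σ : α → L.Sorts) : Nonempty (∀ a, U (σ a)) :=
  ⟨fun a => (MetricStructure.nonempty (L := L) (U := U) (σ a)).some⟩

theorem IsDefPred.exists_bound {α : Type w} {σ : α → L.Sorts} {P : (∀ a, U (σ a)) → ℝ}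
    (hP : IsDefPred A σ P) : ∃ B : ℝ, ∀ x, |P x| ≤ B := by
  obtain ⟨φ, hφ⟩ := hP 1 one_pos
  obtain ⟨B, hB⟩ := Formula.exists_bound U φ
  refine ⟨B + 1, fun x => ?_⟩
  have h₁ : |φ.val x| ≤ B := hB _ _
  have h₂ := hφ x
  rw [abs_le] at *
  constructor <;> linarith

theorem IsDefPred.unif {α : Type w} {σ : α → L.Sorts} {P : (∀ a, U (σ a)) → ℝ}
    (hP : IsDefPred A σ P) {ε : ℝ} (hε : 0 < ε) :
    ∃ δ : ℝ, 0 < δ ∧ ∀ x y, (∀ a, dist (x a) (y a) < δ) → |P x - P y| ≤ ε := by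
  obtain ⟨φ, hφ⟩ := hP (ε / 3) (by positivity)
  obtain ⟨δ, hδ, h⟩ := Formula.unif U φ (ε / 3) (by positivity)
  refine ⟨δ, hδ, fun x y hxy => ?_⟩
  have h₁ : |φ.val x - φ.val y| ≤ ε / 3 := by
    refine h _ _ _ _ ?_ fun i => i.elim0
    rintro (a | c)
    · exact hxy a
    · exact (dist_self _).trans_lt hδ
  have h₂ := hφ x
  have h₃ := hφ y
  rw [abs_le] at *
  constructor <;> linarith

/-- Definable predicates are closed under uniform limits. -/
theorem IsDefPred.of_approx {α : Type w} {σ : α → L.Sorts} {P : (∀ a, U (σ a)) → ℝ}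
    (h : ∀ ε : ℝ, 0 < ε → ∃ Q, IsDefPred A σ Q ∧ ∀ x, |Q x - P x| ≤ ε) : IsDefPred A σ P := by
  intro ε hε
  obtain ⟨Q, hQ, hQP⟩ := h (ε / 2) (by positivity)
  obtain ⟨φ, hφ⟩ := hQ (ε / 2) (by positivity)
  refine ⟨φ, fun x => (abs_sub_le _ (Q x) _).trans ?_⟩
  linarith [hφ x, hQP x]

/-- A free variable, as a term with parameters in `A`. -/
abbrev varTerm (A : ∀ s, Set (U s)) {α : Type w} (σ : α → L.Sorts) {Γ : List L.Sorts} (a : α) :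
    Term L (Sum.elim σ (Sigma.fst : (Σ s, ↥(A s)) → L.Sorts)) Γ (σ a) :=
  Term.free (σ := Sum.elim σ (Sigma.fst : (Σ s, ↥(A s)) → L.Sorts)) (Sum.inl a)

/-- An element of `A`, as a term with parameters in `A`. -/
abbrev paramTerm {A : ∀ s, Set (U s)} {α : Type w} (σ : α → L.Sorts) {Γ : List L.Sorts}
    {s : L.Sorts} (c : U s) (hc : c ∈ A s) :
    Term L (Sum.elim σ (Sigma.fst : (Σ s, ↥(A s)) → L.Sorts)) Γ s :=
  Term.free (σ := Sum.elim σ (Sigma.fst : (Σ s, ↥(A s)) → L.Sorts))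
    (Sum.inr (⟨s, c, hc⟩ : Σ s, ↥(A s)))

/-- Substitution of terms, in particular of variables and of parameters, for the variables of a
definable predicate. The parameters of the predicate are among those of the result. -/
theorem IsDefPred.subst {α : Type w} {σ : α → L.Sorts} {α' : Type w'} {σ' : α' → L.Sorts}
    {P : (∀ a, U (σ a)) → ℝ} (hP : IsDefPred A σ P) (hA : ∀ s, A s ⊆ A' s)
    (f : ∀ a, Term L (Sum.elim σ' (Sigma.fst : (Σ s, ↥(A' s)) → L.Sorts)) [] (σ a)) :
    IsDefPred A' σ' fun x => P fun a =>
      (f a).eval U (Γ := []) (glue x fun c : Σ s, ↥(A' s) => (c.2 : U c.1)) fun i => i.elim0 := by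
  intro ε hε
  obtain ⟨φ, hφ⟩ := hP ε hε
  let f' : ∀ z, Term L (Sum.elim σ' (Sigma.fst : (Σ s, ↥(A' s)) → L.Sorts)) []
      (Sum.elim σ (Sigma.fst : (Σ s, ↥(A s)) → L.Sorts) z)
    | .inl a => f a
    | .inr c => paramTerm σ' c.2.1 (hA _ c.2.2)
  refine ⟨Formula.subst (Γ := []) f' (fun i => i.elim0) φ, fun x => ?_⟩
  refine le_trans (le_of_eq ?_) (hφ fun a =>
    (f a).eval U (Γ := []) (glue x fun c : Σ s, ↥(A' s) => (c.2 : U c.1)) fun i => i.elim0)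
  rw [PFormula.val, Formula.val, Formula.eval_subst]
  congr 2
  unfold PFormula.val Formula.val
  congr 1
  · funext z
    rcases z with a | c <;> rfl
  · funext i
    exact i.elim0

theorem IsDefPred.mono {α : Type w} {σ : α → L.Sorts} {P : (∀ a, U (σ a)) → ℝ}
    (hP : IsDefPred A σ P) (hA : ∀ s, A s ⊆ A' s) : IsDefPred A' σ P :=
  IsDefPred.subst hP hA (varTerm A' σ)

theorem SameType.eq_of_isDefPred {β : Type w} {τ : β → L.Sorts} {a a' : ∀ j, U (τ j)}
    (h : SameType A a a') {P : (∀ j, U (τ j)) → ℝ} (hP : IsDefPred A τ P) : P a = P a' := by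
  refine eq_of_forall_dist_le fun ε hε => ?_
  obtain ⟨φ, hφ⟩ := hP (ε / 2) (by positivity)
  have h₁ := hφ a
  have h₂ := hφ a'
  rw [h φ] at h₁
  rw [Real.dist_eq]
  rw [abs_le] at *
  constructor <;> linarith

theorem uniformContinuous_comp_clamp {k : ℕ} {c : (Fin k → ℝ) → ℝ} (hc : Continuous c) (B : ℝ) :
    UniformContinuous fun y : Fin k → ℝ => c fun i => max (-B) (min B (y i)) := by
  have hK : IsCompact (Set.univ.pi fun _ : Fin k => Set.Icc (min (-B) B) (max (-B) B)) :=
    isCompact_univ_pi fun i => isCompact_Icc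
  have h₁ := hK.uniformContinuousOn_of_continuous hc.continuousOn
  have h₂ : UniformContinuous fun (y : Fin k → ℝ) i => max (-B) (min B (y i)) := by
    refine uniformContinuous_pi.2 fun i => ?_
    have : LipschitzWith 1 fun r : ℝ => max (-B) (min B r) :=
      (LipschitzWith.id.const_min B).const_max (-B)
    exact this.uniformContinuous.comp (Pi.uniformContinuous_proj _ i)
  rw [← uniformContinuousOn_univ] at h₂ ⊢
  refine h₁.comp h₂ fun y _ i _ => ⟨?_, ?_⟩
  · exact (min_le_left _ _).trans (le_max_left _ _)
  · exact max_le (le_max_left _ _) ((min_le_left _ _).trans (le_max_right _ _))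

/-- Definable predicates are closed under continuous connectives, since they are bounded. -/
theorem IsDefPred.comp {α : Type w} {σ : α → L.Sorts} {k : ℕ} {P : Fin k → (∀ a, U (σ a)) → ℝ}
    (hP : ∀ i, IsDefPred A σ (P i)) {c : (Fin k → ℝ) → ℝ} (hc : Continuous c) :
    IsDefPred A σ fun x => c fun i => P i x := by
  intro ε hε
  choose B hB using fun i => (hP i).exists_bound
  obtain ⟨C, hC⟩ := Finite.exists_le B
  have hu := uniformContinuous_comp_clamp hc C
  obtain ⟨δ, hδ, h⟩ := Metric.uniformContinuous_iff.1 hu ε hε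
  choose φ hφ using fun i => hP i (δ / 2) (by positivity)
  -- The connective is `c` after truncation to a box containing all values of the `P i`.
  refine ⟨.conn k _ hu φ, fun x => ?_⟩
  have := h (a := fun i => (φ i).val x) (b := fun i => P i x)
    ((dist_pi_lt_iff hδ).2 fun i => lt_of_le_of_lt (hφ i x) (half_lt_self hδ))
  refine le_trans (le_of_eq ?_) this.le
  rw [Real.dist_eq]
  congr 2
  refine congrArg c (funext fun i => ?_)
  have := abs_le.1 ((hB i x).trans (hC i))
  rw [min_eq_right this.2, max_eq_right this.1]

theorem IsDefPred.comp₁ {α : Type w} {σ : α → L.Sorts} {P : (∀ a, U (σ a)) → ℝ}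
    (hP : IsDefPred A σ P) {c : ℝ → ℝ} (hc : Continuous c) : IsDefPred A σ fun x => c (P x) :=
  IsDefPred.comp (k := 1) (P := fun _ => P) (fun _ => hP) (c := fun y => c (y 0))
    (hc.comp (continuous_apply 0))

theorem IsDefPred.comp₂ {α : Type w} {σ : α → L.Sorts} {P Q : (∀ a, U (σ a)) → ℝ}
    (hP : IsDefPred A σ P) (hQ : IsDefPred A σ Q) {c : ℝ → ℝ → ℝ}
    (hc : Continuous fun y : ℝ × ℝ => c y.1 y.2) : IsDefPred A σ fun x => c (P x) (Q x) :=
  IsDefPred.comp (k := 2) (P := ![P, Q]) (Fin.forall_fin_two.2 ⟨hP, hQ⟩)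
    (c := fun y => c (y 0) (y 1))
    (hc.comp (f := fun y : Fin 2 → ℝ => (y 0, y 1))
      ((continuous_apply (0 : Fin 2)).prodMk (continuous_apply (1 : Fin 2))))

theorem IsDefPred.const {α : Type w} {σ : α → L.Sorts} (r : ℝ) :
    IsDefPred (U := U) A σ fun _ => r :=
  IsDefPred.comp (k := 0) (P := fun i => i.elim0) (fun i => i.elim0) (c := fun _ => r)
    continuous_const

theorem IsDefPred.add {α : Type w} {σ : α → L.Sorts} {P Q : (∀ a, U (σ a)) → ℝ}
    (hP : IsDefPred A σ P) (hQ : IsDefPred A σ Q) : IsDefPred A σ fun x => P x + Q x :=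
  hP.comp₂ hQ (c := fun a b => a + b) (by fun_prop)

theorem IsDefPred.sum {α : Type w} {σ : α → L.Sorts} {ι : Type*} (s : Finset ι)
    {P : ι → (∀ a, U (σ a)) → ℝ} (hP : ∀ i ∈ s, IsDefPred A σ (P i)) :
    IsDefPred A σ fun x => ∑ i ∈ s, P i x := by
  classical
  induction s using Finset.induction_on with
  | empty => simpa using IsDefPred.const 0
  | insert i s hi ih =>
    simp only [Finset.sum_insert hi]
    exact (hP i (Finset.mem_insert_self i s)).add
      (ih fun j hj => hP j (Finset.mem_insert_of_mem hj))

/-! ### Quantification over a definable set -/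

/-- The infimum of a definable predicate over a finite tuple of its variables. -/
theorem IsDefPred.iInf {n : ℕ} {σ : Fin n → L.Sorts} {β : Type w} {τ : β → L.Sorts}
    {P : (∀ z, U (Sum.elim σ τ z)) → ℝ} (hP : IsDefPred A (Sum.elim σ τ) P) :
    IsDefPred A τ fun y => ⨅ x : ∀ i, U (σ i), P (glue x y) := by
  -- The quantified variables are indexed by the positions of a list, as bound variables are.
  obtain ⟨Γ, rfl, hσ⟩ : ∃ (Γ : List L.Sorts) (h : Γ.length = n),
      ∀ i, Γ.get i = σ (Fin.cast h i) :=
    ⟨List.ofFn σ, List.length_ofFn, fun i => by simp [Fin.cast]⟩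
  obtain rfl : Γ.get = σ := funext hσ
  intro ε hε
  obtain ⟨φ, hφ⟩ := hP ε hε
  let f : ∀ z, Term L (Sum.elim τ (Sigma.fst : (Σ s, ↥(A s)) → L.Sorts)) Γ
      (Sum.elim (Sum.elim Γ.get τ) (Sigma.fst : (Σ s, ↥(A s)) → L.Sorts) z)
    | .inl (.inl i) => .bound i
    | .inl (.inr j) => varTerm A τ j
    | .inr c => paramTerm τ c.2.1 c.2.2
  obtain ⟨ψ, hψ⟩ := (Formula.subst (Γ := []) f (fun i => i.elim0) φ).exists_infAll U
  refine ⟨ψ, fun y => ?_⟩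
  have hval : ∀ x : ∀ i, U (Γ.get i), (Formula.subst (Γ := []) f (fun i => i.elim0) φ).eval U
      (glue y fun c : Σ s, ↥(A s) => (c.2 : U c.1)) x = φ.val (glue x y) := by
    intro x
    rw [Formula.eval_subst]
    unfold PFormula.val Formula.val
    congr 1
    · funext z
      rcases z with (i | j) | c <;> rfl
    · funext i
      exact i.elim0
  have hne := nonempty_tuple U Γ.get
  have h := hψ (glue y fun c : Σ s, ↥(A s) => (c.2 : U c.1))
  rw [show (fun e => (Formula.subst (Γ := []) f (fun i => i.elim0) φ).eval U
      (glue y fun c : Σ s, ↥(A s) => (c.2 : U c.1)) e) =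
        fun x => φ.val (glue x y) from funext hval] at h
  have hψy : PFormula.val ψ y = ⨅ x : ∀ i, U (Γ.get i), φ.val (glue x y) := (h.csInf_eq
    (Set.range_nonempty _)).symm
  obtain ⟨B, hB⟩ := hP.exists_bound
  rw [hψy]
  refine abs_ciInf_sub_ciInf_le ⟨_, h.1⟩ ?_ fun x => hφ _
  exact ⟨-B, by rintro _ ⟨x, rfl⟩; exact (abs_le.1 (hB _)).1⟩

/-- A uniformly continuous bounded function is Lipschitz up to an error. -/
theorem exists_lipschitz_up_to {X : Type*} [PseudoMetricSpace X] {ε δ B : ℝ} (hε : 0 ≤ ε)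
    (hδ : 0 < δ) (hB : 0 ≤ B) {f : X → ℝ} (hf : ∀ x, |f x| ≤ B)
    (h : ∀ x y, dist x y < δ → |f x - f y| ≤ ε) (x y : X) :
    |f x - f y| ≤ ε + 2 * B / δ * dist x y := by
  have h0 : 0 ≤ 2 * B / δ * dist x y := by positivity
  by_cases hxy : dist x y < δ
  · linarith [h x y hxy]
  · have h₁ : 2 * B ≤ 2 * B / δ * dist x y := by
      rw [div_mul_eq_mul_div, le_div_iff₀ hδ]
      exact mul_le_mul_of_nonneg_left (not_lt.1 hxy) (by positivity)
    have h₂ := abs_le.1 (hf x)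
    have h₃ := abs_le.1 (hf y)
    rw [abs_le]
    constructor <;> linarith

theorem IsDefPred.exists_lipschitz_up_to {n : ℕ} {σ : Fin n → L.Sorts} {β : Type w}
    {τ : β → L.Sorts} {P : (∀ z, U (Sum.elim σ τ z)) → ℝ} (hP : IsDefPred A (Sum.elim σ τ) P)
    {ε : ℝ} (hε : 0 < ε) :
    ∃ K : ℝ, 0 ≤ K ∧ ∀ x x' y, |P (glue x y) - P (glue x' y)| ≤ ε + K * dist x x' := by
  obtain ⟨δ, hδ, h⟩ := hP.unif hε
  obtain ⟨B, hB⟩ := hP.exists_bound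
  have hne := nonempty_tuple U (Sum.elim σ τ)
  have hB0 : 0 ≤ B := (abs_nonneg _).trans (hB (Classical.arbitrary _))
  refine ⟨2 * B / δ, by positivity, fun x x' y => ?_⟩
  refine ContLogic.exists_lipschitz_up_to (f := fun x => P (glue x y)) hε.le hδ hB0
    (fun x => hB _) (fun x x' hx => h _ _ ?_) x x'
  rintro (i | j)
  · exact (dist_le_pi_dist x x' i).trans_lt hx
  · exact (dist_self (y j)).trans_lt hδ

/-- The infimum of a definable predicate over a set with definable distance: it is the infimum over
all tuples of the predicate penalized by a large multiple of the distance. -/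
theorem IsDefPred.iInf_mem {n : ℕ} {σ : Fin n → L.Sorts} {β : Type w} {τ : β → L.Sorts}
    {G : Set (∀ i, U (σ i))} (hne : G.Nonempty)
    (hG : IsDefPred A σ fun x => Metric.infDist x G)
    {P : (∀ z, U (Sum.elim σ τ z)) → ℝ} (hP : IsDefPred A (Sum.elim σ τ) P) :
    IsDefPred A τ fun y => ⨅ x : G, P (glue x.1 y) := by
  refine IsDefPred.of_approx fun ε hε => ?_
  obtain ⟨K, hK, hlip⟩ := hP.exists_lipschitz_up_to (ε := ε / 2) (by positivity)
  have hd : IsDefPred A (Sum.elim σ τ) fun z => Metric.infDist (fun i => z (.inl i)) G :=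
    IsDefPred.subst hG (fun _ => subset_rfl) fun i =>
      varTerm A (Sum.elim σ τ) (.inl i)
  refine ⟨_, (hP.add (hd.comp₁ (c := fun r => K * r) (by fun_prop))).iInf, fun y => ?_⟩
  obtain ⟨B, hB⟩ := hP.exists_bound
  have hbdd : BddBelow (Set.range fun x : G => P (glue x.1 y)) :=
    ⟨-B, by rintro _ ⟨x, rfl⟩; exact (abs_le.1 (hB _)).1⟩
  have hbdd' : BddBelow (Set.range fun x : ∀ i, U (σ i) =>
      P (glue x y) +
        K * Metric.infDist (fun i => (glue x y : ∀ z, U (Sum.elim σ τ z)) (.inl i)) G) :=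
    ⟨-B, by
      rintro _ ⟨x, rfl⟩
      exact (abs_le.1 (hB _)).1.trans (le_add_of_nonneg_right
        (mul_nonneg hK Metric.infDist_nonneg))⟩
  have hne' : Nonempty G := hne.to_subtype
  have hne'' := nonempty_tuple U σ
  rw [abs_le]
  constructor
  · rw [neg_le_sub_iff_le_add, ← sub_le_iff_le_add]
    refine le_ciInf fun x => ?_
    change _ ≤ P (glue x y) + K * Metric.infDist x G
    have hη : 0 < ε / 2 / (K + 1) := by positivity
    obtain ⟨x', hx', hxx'⟩ := (Metric.infDist_lt_iff hne).1 (lt_add_of_pos_right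
      (Metric.infDist x G) hη)
    have h₁ := ciInf_le hbdd ⟨x', hx'⟩
    have h₂ := (abs_le.1 (hlip x x' y)).1
    have h₃ : K * dist x x' ≤ K * (Metric.infDist x G + ε / 2 / (K + 1)) :=
      mul_le_mul_of_nonneg_left hxx'.le hK
    have h₄ : K * (ε / 2 / (K + 1)) ≤ ε / 2 := by
      rw [mul_div_assoc', div_le_iff₀ (by positivity)]
      nlinarith
    simp only at h₁
    linarith
  · rw [sub_le_iff_le_add]
    refine (le_ciInf fun x : G => ?_).trans (le_add_of_nonneg_left hε.le)
    refine (ciInf_le hbdd' x.1).trans ?_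
    change P (glue x.1 y) + K * Metric.infDist x.1 G ≤ _
    rw [Metric.infDist_zero_of_mem x.2, mul_zero, add_zero]

end DefinablePredicates

/-! ### Small parameter sets -/

/-- The parameters in `A` together with the entries of a sequence of tuples. -/
def seqParams {L : MetricLanguage.{u}} {U : L.Sorts → Type u} (A : ∀ s, Set (U s))
    {β : Type u} {τ : β → L.Sorts} (b : ℕ → ∀ j, U (τ j)) :
    ∀ s, Set (U s) :=
  fun s => A s ∪ {c | ∃ i j, (⟨τ j, b i j⟩ : Σ s, U s) = ⟨s, c⟩}

theorem mk_seqParams_lt {L : MetricLanguage.{u}} {U : L.Sorts → Type u} {A : ∀ s, Set (U s)}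
    {κ : Cardinal.{u}} (hκ : ℵ₀ < κ) (hA : #(Σ s, ↥(A s)) < κ) {β : Type u}
    (hβ : #β < κ) {τ : β → L.Sorts} (b : ℕ → ∀ j, U (τ j)) :
    #(Σ s, ↥(seqParams A b s)) < κ := by
  let f : (Σ s, ↥(A s)) ⊕ (ℕ × β) → Σ s, ↥(seqParams A b s)
    | .inl c => ⟨c.1, c.2.1, Or.inl c.2.2⟩
    | .inr c => ⟨τ c.2, b c.1 c.2, Or.inr ⟨c.1, c.2, rfl⟩⟩
  have hf : Function.Surjective f := by
    rintro ⟨s, c, hc | ⟨i, j, hij⟩⟩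
    · exact ⟨.inl ⟨s, c, hc⟩, rfl⟩
    · cases hij
      exact ⟨.inr (i, j), rfl⟩
  refine (Cardinal.mk_le_of_surjective hf).trans_lt ?_
  rw [Cardinal.mk_sum, Cardinal.mk_prod]
  simp only [Cardinal.lift_id, Cardinal.lift_uzero, Cardinal.mk_nat, Cardinal.lift_aleph0]
  exact Cardinal.add_lt_of_lt hκ.le hA (Cardinal.mul_lt_of_lt hκ.le hκ hβ)

section Predicates

variable {L : MetricLanguage.{u}} {U : L.Sorts → Type u} [∀ s, MetricSpace (U s)]
  [MetricStructure L U] {A A' : ∀ s, Set (U s)} {n : ℕ} {σ : Fin n → L.Sorts}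
  {G : Set (∀ i, U (σ i))}

/-! ### Indiscernible sequences -/

theorem isDefPred_val {α : Type w} {σ : α → L.Sorts} (φ : PFormula A σ) :
    IsDefPred A σ fun x => φ.val x :=
  fun ε hε => ⟨φ, fun x => by simpa using hε.le⟩

/-- Tuples obtained by reading off finitely many members of an indiscernible sequence, in any
arrangement of the coordinates, have a type that depends on the arrangement only. -/
theorem Indiscernible.sameType {β : Type w} {τ : β → L.Sorts} {b : ℕ → ∀ j, U (τ j)}
    (hb : Indiscernible A b) {γ : Type w'} {N : ℕ} (pos : γ → Fin N) (var : γ → β)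
    (f g : Fin N ↪o ℕ) :
    SameType A (τ := fun c => τ (var c)) (fun c => b (f (pos c)) (var c))
      (fun c => b (g (pos c)) (var c)) := by
  intro φ
  exact (hb N f g).eq_of_isDefPred (IsDefPred.subst (isDefPred_val φ) (fun _ => subset_rfl)
    fun c => varTerm A (fun z : Fin N × β => τ z.2) (pos c, var c))

theorem Indiscernible.sameType_single {β : Type w} {τ : β → L.Sorts} {b : ℕ → ∀ j, U (τ j)}
    (hb : Indiscernible A b) (i j : ℕ) : SameType A (b i) (b j) :=
  hb.sameType (N := 1) (fun _ => 0) id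
    (OrderEmbedding.ofStrictMono (fun _ => i) (Subsingleton.strictMono _))
    (OrderEmbedding.ofStrictMono (fun _ => j) (Subsingleton.strictMono _))

/-- The concatenation of two tuples of the same shape. -/
def pairTuple {β : Type w} {τ : β → L.Sorts} (a a' : ∀ j, U (τ j)) :
    ∀ z : Fin 2 × β, U (τ z.2) :=
  fun z => if z.1 = 0 then a z.2 else a' z.2

theorem Indiscernible.sameType_pair {β : Type w} {τ : β → L.Sorts} {b : ℕ → ∀ j, U (τ j)}
    (hb : Indiscernible A b) {i j k l : ℕ} (hij : i < j) (hkl : k < l) :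
    SameType A (τ := fun z : Fin 2 × β => τ z.2) (pairTuple (b i) (b j))
      (pairTuple (b k) (b l)) := by
  have key : ∀ i j : ℕ, pairTuple (b i) (b j) = fun z : Fin 2 × β => b (![i, j] z.1) z.2 := by
    intro i j
    funext ⟨t, z⟩
    fin_cases t <;> rfl
  have hmono : ∀ {i j : ℕ}, i < j → StrictMono ![i, j] := fun h => by
    rw [Fin.strictMono_iff_lt_succ]
    intro t
    fin_cases t
    simpa using h
  rw [key, key]
  exact hb 2 (OrderEmbedding.ofStrictMono _ (hmono hij)) (OrderEmbedding.ofStrictMono _ (hmono hkl))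

/-- Grouping an indiscernible sequence into consecutive pairs gives an indiscernible sequence. -/
theorem Indiscernible.pairs {β : Type w} {τ : β → L.Sorts} {b : ℕ → ∀ j, U (τ j)}
    (hb : Indiscernible A b) :
    Indiscernible A (τ := fun z : Fin 2 × β => τ z.2)
      fun i => pairTuple (b (2 * i)) (b (2 * i + 1)) := by
  intro n f g
  -- The members of the original sequence that occur in the pairs selected by `f`.
  let d : (Fin n ↪o ℕ) → Fin (2 * n) ↪o ℕ := fun f =>
    OrderEmbedding.ofStrictMono (fun k => 2 * f ⟨k / 2, by omega⟩ + k % 2) fun k l hkl => by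
      rcases (Nat.div_le_div_right (c := 2) hkl.le).lt_or_eq with h | h
      · have := f.strictMono (show (⟨k / 2, by omega⟩ : Fin n) < ⟨l / 2, by omega⟩ from h)
        simp only
        omega
      · have : (k : ℕ) < l := hkl
        simp only [h]
        omega
  have h := hb.sameType (N := 2 * n) (γ := Fin n × (Fin 2 × β))
    (fun z : Fin n × (Fin 2 × β) => ⟨2 * z.1 + z.2.1, by omega⟩) (fun z => z.2.2) (d f) (d g)
  have key : ∀ f : Fin n ↪o ℕ, (fun z : Fin n × (Fin 2 × β) =>
      b (d f ⟨2 * z.1 + z.2.1, by omega⟩) z.2.2) =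
      fun z : Fin n × (Fin 2 × β) =>
        pairTuple (b (2 * f z.1)) (b (2 * f z.1 + 1)) z.2 := by
    intro f
    funext ⟨i, t, z⟩
    have hd : d f ⟨2 * i + t, by omega⟩ = 2 * f i + t := by
      have hi : (⟨(2 * i + t) / 2, by omega⟩ : Fin n) = i := Fin.ext (by simp only; omega)
      have ht : (2 * (i : ℕ) + t) % 2 = t := by omega
      change 2 * f ⟨(2 * i + t) / 2, by omega⟩ + (2 * (i : ℕ) + t) % 2 = _
      rw [hi, ht]
    simp only [hd]
    fin_cases t <;> rfl
  rw [key, key] at h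
  exact h

/-! ### Predicates on a definable group -/

theorem IsDefPred.inst {β : Type w} {τ : β → L.Sorts} {R : (∀ z, U (Sum.elim σ τ z)) → ℝ}
    (hR : IsDefPred A (Sum.elim σ τ) R) (hA : ∀ s, A s ⊆ A' s) {b : ∀ j, U (τ j)}
    (hb : ∀ j, b j ∈ A' (τ j)) : IsDefPred A' σ fun x => R (glue x b) := by
  let f : ∀ z, Term L (Sum.elim σ (Sigma.fst : (Σ s, ↥(A' s)) → L.Sorts)) [] (Sum.elim σ τ z)
    | .inl i => varTerm A' σ i
    | .inr j => paramTerm σ (b j) (hb j)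
  convert IsDefPred.subst hR hA f using 3 with x
  funext z
  rcases z with i | j <;> rfl

theorem inst_mem_pred {β : Type w} {τ : β → L.Sorts} {R : (∀ z, U (Sum.elim σ τ z)) → ℝ}
    (hR : IsDefPred A (Sum.elim σ τ) R) (b : ∀ j, U (τ j)) :
    (inst R b : G → ℝ) ∈ Pred G (allParams U) :=
  ⟨_, hR.inst (A' := allParams U) (fun _ => Set.subset_univ _) fun _ => Set.mem_univ _,
    fun _ => rfl⟩

theorem Pred.comp₁ {P : G → ℝ} (hP : P ∈ Pred G A) {c : ℝ → ℝ} (hc : Continuous c) :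
    (fun x => c (P x)) ∈ Pred G A := by
  obtain ⟨P', hP', h⟩ := hP
  exact ⟨_, hP'.comp₁ hc, fun x => congrArg c (h x)⟩

theorem Pred.comp₂ {P Q : G → ℝ} (hP : P ∈ Pred G A) (hQ : Q ∈ Pred G A) {c : ℝ → ℝ → ℝ}
    (hc : Continuous fun y : ℝ × ℝ => c y.1 y.2) : (fun x => c (P x) (Q x)) ∈ Pred G A := by
  obtain ⟨P', hP', h⟩ := hP
  obtain ⟨Q', hQ', h'⟩ := hQ
  exact ⟨_, hP'.comp₂ hQ' hc, fun x => congrArg₂ c (h x) (h' x)⟩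

theorem Pred.const (r : ℝ) : (fun _ => r) ∈ Pred G A :=
  ⟨_, IsDefPred.const r, fun _ => rfl⟩

theorem Pred.add {P Q : G → ℝ} (hP : P ∈ Pred G A) (hQ : Q ∈ Pred G A) : P + Q ∈ Pred G A :=
  Pred.comp₂ hP hQ (c := fun a b => a + b) (by fun_prop)

theorem Pred.mul {P Q : G → ℝ} (hP : P ∈ Pred G A) (hQ : Q ∈ Pred G A) : P * Q ∈ Pred G A :=
  Pred.comp₂ hP hQ (c := fun a b => a * b) (by fun_prop)

theorem Pred.sum {ι : Type*} (s : Finset ι) {P : ι → G → ℝ} (hP : ∀ i ∈ s, P i ∈ Pred G A) :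
    (fun x => ∑ i ∈ s, P i x) ∈ Pred G A := by
  classical
  induction s using Finset.induction_on with
  | empty => simpa using Pred.const 0
  | insert i s hi ih =>
    simp only [Finset.sum_insert hi]
    exact Pred.add (hP i (Finset.mem_insert_self i s))
      (ih fun j hj => hP j (Finset.mem_insert_of_mem hj))

theorem abs_clamp_le {r : ℝ} (hr : 0 ≤ r) (t : ℝ) : |max (-r) (min r t)| ≤ r :=
  abs_le.2 ⟨le_max_left _ _, max_le (by linarith) (min_le_left _ _)⟩

theorem clamp_eq {r t : ℝ} (h : |t| ≤ r) : max (-r) (min r t) = t := by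
  rw [min_eq_right (abs_le.1 h).2, max_eq_right (abs_le.1 h).1]

/-- A function on `G` that is uniformly approximated on `G` by definable predicates is the
restriction of a definable predicate. The approximations need not converge away from `G`, so their
differences are truncated to make the telescoping series converge uniformly everywhere. -/
theorem Pred.of_approx {P : G → ℝ}
    (h : ∀ ε : ℝ, 0 < ε → ∃ Q, IsDefPred A σ Q ∧ ∀ x : G, |P x - Q x.1| ≤ ε) :
    P ∈ Pred G A := by
  choose H hH hHP using fun k : ℕ => h (1 / 2 ^ k) (by positivity)
  let r : ℕ → ℝ := fun k => 4 / 2 / 2 ^ k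
  let D : ℕ → (∀ i, U (σ i)) → ℝ := fun k x => max (-r k) (min (r k) (H (k + 1) x - H k x))
  let S : ℕ → (∀ i, U (σ i)) → ℝ := fun k x => H 0 x + ∑ i ∈ Finset.range k, D i x
  have hr : ∀ k, 0 ≤ r k := fun k => by positivity
  have hS : ∀ k, IsDefPred A σ (S k) := fun k =>
    (hH 0).add (IsDefPred.sum _ fun i _ =>
      (hH (i + 1)).comp₂ (hH i) (c := fun a b => max (-r i) (min (r i) (a - b))) (by fun_prop))
  have hdist : ∀ x k, dist (S k x) (S (k + 1) x) ≤ 4 / 2 / 2 ^ k := by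
    intro x k
    rw [dist_comm, Real.dist_eq]
    simp only [S, Finset.sum_range_succ]
    rw [show ∀ a b c : ℝ, a + (b + c) - (a + b) = c by intros; ring]
    exact abs_clamp_le (hr k) _
  have hconv : ∀ x, ∃ y, Tendsto (fun k => S k x) atTop (𝓝 y) := fun x =>
    cauchySeq_tendsto_of_complete (cauchySeq_of_le_geometric_two (hdist x))
  choose Q hQ using hconv
  have hunif : ∀ k x, |S k x - Q x| ≤ 4 / 2 ^ k := fun k x =>
    dist_le_of_le_geometric_two_of_tendsto (hdist x) (hQ x) k
  have hpow : Tendsto (fun k : ℕ => (4 : ℝ) / 2 ^ k) atTop (𝓝 0) := by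
    have := (tendsto_pow_atTop_nhds_zero_of_lt_one (r := (1 / 2 : ℝ)) (by norm_num)
      (by norm_num)).const_mul 4
    simpa [div_eq_mul_inv] using this
  refine ⟨Q, IsDefPred.of_approx fun ε hε => ?_, fun x => ?_⟩
  · obtain ⟨k, hk⟩ := (hpow.eventually (gt_mem_nhds hε)).exists
    exact ⟨S k, hS k, fun x => (hunif k x).trans hk.le⟩
  · have hSx : ∀ k, S k x.1 = H k x.1 := by
      intro k
      induction k with
      | zero => simp [S]
      | succ k ih =>
        have hD : D k x.1 = H (k + 1) x.1 - H k x.1 := by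
          refine clamp_eq ?_
          have h₁ := abs_le.1 (hHP k x)
          have h₂ := abs_le.1 (hHP (k + 1) x)
          have h₃ : (1 : ℝ) / 2 ^ (k + 1) ≤ 1 / 2 ^ k :=
            one_div_le_one_div_of_le (by positivity) (pow_le_pow_right₀ one_le_two (Nat.le_succ k))
          have h₄ : r k = 2 * (1 / 2 ^ k) := by simp only [r]; ring
          rw [abs_le, h₄]
          constructor <;> linarith
        have : S (k + 1) x.1 = S k x.1 + D k x.1 := by
          simp only [S, Finset.sum_range_succ]; ring
        rw [this, ih, hD]
        ring
    refine eq_of_forall_dist_le fun ε hε => ?_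
    obtain ⟨k, hk⟩ := (hpow.eventually (gt_mem_nhds (half_pos hε))).exists
    have h₁ := hHP k x
    have h₂ := hunif k x.1
    have h₃ : (1 : ℝ) / 2 ^ k ≤ 4 / 2 ^ k := by gcongr; norm_num
    rw [hSx] at h₂
    rw [Real.dist_eq]
    refine (abs_sub_le _ (H k x.1) _).trans ?_
    linarith

theorem IsDefinableGroup.iInf_isDefPred [Group G] (hG : IsDefinableGroup A G) {β : Type w}
    {τ : β → L.Sorts} {R : (∀ z, U (Sum.elim σ τ z)) → ℝ}
    (hR : IsDefPred A (Sum.elim σ τ) R) : IsDefPred A τ fun y => ⨅ x : G, R (glue x.1 y) :=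
  IsDefPred.iInf_mem ⟨_, (1 : G).2⟩ hG.dist_def hR

/-- Positivity on the group of `R(x, a)` depends on the type of `a` only. -/
theorem IsDefinableGroup.inst_mem_posPred [Group G] (hG : IsDefinableGroup A G) {β : Type w}
    {τ : β → L.Sorts} {R : (∀ z, U (Sum.elim σ τ z)) → ℝ}
    (hR : IsDefPred A (Sum.elim σ τ) R) {a a' : ∀ j, U (τ j)} (haa' : SameType A a a')
    (h : (inst R a : G → ℝ) ∈ PosPred G) : (inst R a' : G → ℝ) ∈ PosPred G := by
  refine ⟨inst_mem_pred hR a', fun x => ?_⟩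
  have h₁ := haa'.eq_of_isDefPred (hG.iInf_isDefPred hR)
  have h₂ : 0 ≤ ⨅ x : G, R (glue x.1 a) := le_ciInf h.2
  obtain ⟨B, hB⟩ := hR.exists_bound
  rw [h₁] at h₂
  exact h₂.trans (ciInf_le ⟨-B, by rintro _ ⟨x, rfl⟩; exact (abs_le.1 (hB _)).1⟩ x)

/-- Translates of predicates are predicates: `P(gx)` is approximated by the infimum over `z` in the
group of `P(z) + K d(gx, z)` for large `K`. -/
theorem IsDefinableGroup.translate_mem_pred [Group G] (hG : IsDefinableGroup A G) (g : G)
    {P : G → ℝ} (hP : P ∈ Pred G (allParams U)) :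
    (fun x => P (g * x)) ∈ Pred G (allParams U) := by
  obtain ⟨P', hP', hPP'⟩ := hP
  obtain ⟨Q, hQ, hQd⟩ := hG.mul_def
  have hsub : ∀ s, A s ⊆ allParams U s := fun s => Set.subset_univ _
  refine Pred.of_approx fun ε hε => ?_
  obtain ⟨δ, hδ, hunif⟩ := hP'.unif hε
  obtain ⟨B, hB⟩ := hP'.exists_bound
  have hB0 : 0 ≤ B := (abs_nonneg _).trans (hB g.1)
  have hlip := exists_lipschitz_up_to hε.le hδ hB0 (f := P) (fun x => by rw [hPP']; exact hB _)
    fun x y hxy => by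
      rw [hPP', hPP']
      exact hunif _ _ fun i => (dist_le_pi_dist x.1 y.1 i).trans_lt hxy
  set K := 2 * B / δ with hK
  have hK0 : 0 ≤ K := by positivity
  -- The variables are `z` (to be quantified) and `x`.
  have h₁ : IsDefPred (allParams U) (Sum.elim σ σ) fun y => P' fun i => y (.inl i) :=
    IsDefPred.subst hP' (fun _ => subset_rfl) fun i => varTerm _ (Sum.elim σ σ) (.inl i)
  let f : ∀ c, Term L (Sum.elim (Sum.elim σ σ) (Sigma.fst : (Σ s, ↥(allParams U s)) → L.Sorts)) []
      (Sum.elim σ (Sum.elim σ σ) c)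
    | .inl i => paramTerm (Sum.elim σ σ) (g.1 i) (Set.mem_univ _)
    | .inr (.inl i) => varTerm _ (Sum.elim σ σ) (.inr i)
    | .inr (.inr i) => varTerm _ (Sum.elim σ σ) (.inl i)
  have h₂ := (IsDefPred.subst hQ hsub f).comp₁ (c := fun r => K * r) (by fun_prop)
  refine ⟨_, IsDefPred.iInf_mem ⟨_, (1 : G).2⟩ (hG.dist_def.mono hsub) (h₁.add h₂), fun x => ?_⟩
  have hval : ∀ z : G, (P' fun i => (glue z.1 x.1 : ∀ c, U (Sum.elim σ σ c)) (.inl i)) +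
      K * Q (fun c => (f c).eval U (Γ := [])
        (glue (glue z.1 x.1) fun c : Σ s, ↥(allParams U s) => (c.2 : U c.1)) fun i => i.elim0) =
      P z + K * dist (g * x) z := by
    intro z
    rw [← hQd, hPP']
    congr 3
    funext c
    rcases c with i | i | i <;> rfl
  rw [iInf_congr hval]
  have hbdd : BddBelow (Set.range fun z : G => P z + K * dist (g * x) z) := by
    refine ⟨-B, ?_⟩
    rintro _ ⟨z, rfl⟩
    have := (abs_le.1 (hB z.1)).1
    rw [← hPP'] at this
    exact this.trans (le_add_of_nonneg_right (by positivity))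
  have hup : (⨅ z : G, P z + K * dist (g * x) z) ≤ P (g * x) :=
    (ciInf_le hbdd (g * x)).trans (by simp)
  have hlo : P (g * x) - ε ≤ ⨅ z : G, P z + K * dist (g * x) z :=
    le_ciInf fun z => by linarith [(abs_le.1 (hlip (g * x) z)).2]
  rw [abs_le]
  constructor <;> linarith

/-! ### Saturation -/

theorem uniformContinuous_truncation (ε : ℝ) :
    UniformContinuous fun y : Fin 1 → ℝ => max (|y 0| - ε) 0 := by
  have h₁ : LipschitzWith 1 fun r : ℝ => max r 0 := LipschitzWith.id.max_const 0
  have h₂ : UniformContinuous fun r : ℝ => |r| - ε :=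
    (uniformContinuous_norm (E := ℝ)).sub uniformContinuous_const
  exact h₁.uniformContinuous.comp (h₂.comp (Pi.uniformContinuous_proj _ 0))

/-- Saturation for definable predicates in place of formulas. -/
theorem IsSaturated.exists_of_isDefPred {κ : Cardinal.{u}} (hsat : IsSaturated U κ)
    (hA : #(Σ s, ↥(A s)) < κ) {Ψ : Set ((∀ i, U (σ i)) → ℝ)} (hΨ : ∀ P ∈ Ψ, IsDefPred A σ P)
    (hfin : ∀ F : Finset ((∀ i, U (σ i)) → ℝ), (F : Set ((∀ i, U (σ i)) → ℝ)) ⊆ Ψ →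
      ∀ ε : ℝ, 0 < ε → ∃ x, ∀ P ∈ F, |P x| ≤ ε) : ∃ x, ∀ P ∈ Ψ, P x = 0 := by
  classical
  obtain ⟨x, hx⟩ := hsat A hA n σ {ψ | ∃ P ∈ Ψ, ∀ x, |ψ.val x| ≤ |P x|} fun F hF ε hε => by
    choose! P hP hPle using hF
    obtain ⟨x, hx⟩ := hfin (F.image P) (by
      intro Q hQ
      obtain ⟨ψ, hψ, rfl⟩ := Finset.mem_image.1 (Finset.mem_coe.1 hQ)
      exact hP hψ) ε hε
    exact ⟨x, fun ψ hψ => (hPle hψ x).trans (hx _ (Finset.mem_image_of_mem P hψ))⟩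
  refine ⟨x, fun P hP => abs_nonpos_iff.1 (le_of_forall_pos_le_add fun ε hε => ?_)⟩
  obtain ⟨φ, hφ⟩ := hΨ P hP (ε / 2) (by positivity)
  have h : max (|φ.val x| - ε / 2) 0 = 0 := by
    refine hx (.conn 1 _ (uniformContinuous_truncation (ε / 2)) fun _ => φ) ⟨P, hP, fun y => ?_⟩
    change |max (|φ.val y| - ε / 2) 0| ≤ |P y|
    rw [abs_of_nonneg (le_max_right _ _)]
    refine max_le ?_ (abs_nonneg _)
    have := hφ y
    have := abs_sub_abs_le_abs_sub (φ.val y) (P y)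
    linarith
  have h₁ := max_eq_right_iff.1 h
  have h₂ := hφ x
  have h₃ := abs_sub_abs_le_abs_sub (P x) (φ.val x)
  rw [abs_sub_comm] at h₃
  linarith

/-- If the conditions `R(x, b i) = 0` for `R ∈ Φ` and `i < ω` have no common solution in the group,
then finitely many of them already have a positive lower bound. -/
theorem IsDefinableGroup.exists_pos_le_sum {κ : Cardinal.{u}} (hκ : ℵ₀ < κ)
    (hsat : IsSaturated U κ) (hA : #(Σ s, ↥(A s)) < κ) [Group G] (hG : IsDefinableGroup A G)
    {β : Type u} (hβ : #β < κ) {τ : β → L.Sorts} (b : ℕ → ∀ j, U (τ j))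
    {Φ : Set ((∀ z, U (Sum.elim σ τ z)) → ℝ)} (hΦ : ∀ R ∈ Φ, IsDefPred A (Sum.elim σ τ) R)
    (h : ¬ ∃ x : G, ∀ i, ∀ R ∈ Φ, inst R (b i) x = 0) :
    ∃ F : Finset ((∀ z, U (Sum.elim σ τ z)) → ℝ), (F : Set _) ⊆ Φ ∧ ∃ N : ℕ, ∃ ε : ℝ, 0 < ε ∧
      ∀ x : G, ε ≤ ∑ i ∈ Finset.range N, ∑ R ∈ F, |R (glue x.1 (b i))| := by
  classical
  by_contra! hcon
  refine h ?_
  have hsub : ∀ s, A s ⊆ seqParams A b s := fun s => Set.subset_union_left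
  let cond : ((∀ z, U (Sum.elim σ τ z)) → ℝ) × ℕ → (∀ i, U (σ i)) → ℝ :=
    fun p x => p.1 (glue x (b p.2))
  obtain ⟨x, hx⟩ := hsat.exists_of_isDefPred (mk_seqParams_lt hκ hA hβ b) (σ := σ)
    (Ψ := insert (fun x => Metric.infDist x G) (cond '' (Φ ×ˢ Set.univ))) (by
      rintro _ (rfl | ⟨⟨R, i⟩, ⟨hR, -⟩, rfl⟩)
      · exact hG.dist_def.mono hsub
      · exact (hΦ R hR).inst hsub fun j => Or.inr ⟨i, j, rfl⟩) (by
      intro F' hF' ε hε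
      -- Apart from the distance to `G`, the finitely many conditions come from a finite set `T` of
      -- pairs `(R, i)`.
      obtain ⟨T, hT, hTF⟩ := Finset.subset_set_image_iff.1
        (show ((F'.erase fun x => Metric.infDist x G : Finset _) : Set _) ⊆
            cond '' (Φ ×ˢ Set.univ) from fun P hP => by
          rw [Finset.coe_erase] at hP
          exact (hF' hP.1).resolve_left hP.2)
      obtain ⟨N, hN⟩ := (T.image Prod.snd).exists_nat_subset_range
      obtain ⟨x, hx⟩ := hcon (T.image Prod.fst) (by
        intro R hR
        obtain ⟨p, hp, rfl⟩ := Finset.mem_image.1 (Finset.mem_coe.1 hR)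
        exact (hT hp).1) N ε hε
      refine ⟨x.1, fun P hP => ?_⟩
      by_cases hPd : P = fun x => Metric.infDist x G
      · rw [hPd]
        simp only [Metric.infDist_zero_of_mem x.2, abs_zero]
        exact hε.le
      · have hP' := Finset.mem_erase.2 ⟨hPd, hP⟩
        rw [← hTF] at hP'
        obtain ⟨p, hp, rfl⟩ := Finset.mem_image.1 hP'
        refine le_trans ?_ hx.le
        have h₁ : |p.1 (glue x.1 (b p.2))| ≤ ∑ R ∈ T.image Prod.fst, |R (glue x.1 (b p.2))| :=
          Finset.single_le_sum (f := fun R : (∀ z, U (Sum.elim σ τ z)) → ℝ =>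
            |R (glue x.1 (b p.2))|) (fun _ _ => abs_nonneg _) (Finset.mem_image_of_mem _ hp)
        exact h₁.trans (Finset.single_le_sum
          (f := fun i => ∑ R ∈ T.image Prod.fst, |R (glue x.1 (b i))|)
          (fun _ _ => Finset.sum_nonneg fun _ _ => abs_nonneg _)
          (hN (Finset.mem_image_of_mem _ hp))))
  have hxG : x ∈ G := (hG.closed.mem_iff_infDist_zero ⟨_, (1 : G).2⟩).2 (hx _ (Or.inl rfl))
  exact ⟨⟨x, hxG⟩, fun i R hR => hx _ (Or.inr ⟨(R, i), ⟨hR, trivial⟩, rfl⟩)⟩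

end Predicates

section Ideals

variable {L : MetricLanguage.{u}} {U : L.Sorts → Type u} [∀ s, MetricSpace (U s)]
  [MetricStructure L U] {A D : ∀ s, Set (U s)} {n : ℕ} {σ : Fin n → L.Sorts}
  {G : Set (∀ i, U (σ i))}

/-! ### Complete types -/

theorem Pred.mono {A' : ∀ s, Set (U s)} (h : ∀ s, A s ⊆ A' s) : Pred G A ⊆ Pred G A' :=
  fun _ ⟨Q, hQ, hPQ⟩ => ⟨Q, hQ.mono h, hPQ⟩

/-- A complete type contains every predicate that is forced to be small by finitely many of its
members being small. -/
theorem IsCompleteType.mem_of_forall {p : Set (G → ℝ)} (hp : IsCompleteType D p) {P : G → ℝ}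
    (hP : P ∈ Pred G D) (F : Finset (G → ℝ)) (hF : (F : Set (G → ℝ)) ⊆ p)
    (h : ∀ ε : ℝ, 0 < ε → ∃ δ : ℝ, 0 < δ ∧ ∀ x, (∀ Q ∈ F, |Q x| ≤ δ) → |P x| ≤ ε) : P ∈ p := by
  classical
  refine hp.2 (y := insert P p) ⟨Set.insert_subset hP hp.1.1, fun F' hF' ε hε => ?_⟩
    (Set.subset_insert P p) (Set.mem_insert P p)
  obtain ⟨δ, hδ, hδP⟩ := h ε hε
  obtain ⟨x, hx⟩ := hp.1.2 (F'.erase P ∪ F) (by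
    intro Q hQ
    rcases Finset.mem_union.1 (Finset.mem_coe.1 hQ) with hQ | hQ
    · obtain ⟨hne, hQ⟩ := Finset.mem_erase.1 hQ
      exact (hF' hQ).resolve_left hne
    · exact hF hQ) (min ε δ) (lt_min hε hδ)
  refine ⟨x, fun Q hQ => ?_⟩
  by_cases hQP : Q = P
  · rw [hQP]
    exact hδP x fun R hR => (hx R (Finset.mem_union_right _ hR)).trans (min_le_right _ _)
  · exact (hx Q (Finset.mem_union_left _ (Finset.mem_erase.2 ⟨hQP, hQ⟩))).trans (min_le_left _ _)

theorem IsCompleteType.sum_abs_mem {p : Set (G → ℝ)} (hp : IsCompleteType D p) {ι : Type*}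
    (s : Finset ι) {P : ι → G → ℝ} (hP : ∀ i ∈ s, P i ∈ p) :
    (fun x => ∑ i ∈ s, |P i x|) ∈ p := by
  classical
  refine hp.mem_of_forall (Pred.sum s fun i hi => Pred.comp₁ (hp.1.1 (hP i hi)) continuous_abs)
    (s.image P) (fun Q hQ => ?_) fun ε hε => ⟨ε / (s.card + 1), by positivity, fun x hx => ?_⟩
  · obtain ⟨i, hi, rfl⟩ := Finset.mem_image.1 (Finset.mem_coe.1 hQ)
    exact hP i hi
  · rw [abs_of_nonneg (Finset.sum_nonneg fun _ _ => abs_nonneg _)]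
    refine (Finset.sum_le_card_nsmul s _ _ fun i hi => hx _ (Finset.mem_image_of_mem P hi)).trans ?_
    rw [nsmul_eq_mul, mul_div_assoc', div_le_iff₀ (by positivity)]
    nlinarith

theorem IsDefinableGroup.translateType_isGlobalType [Group G] (hG : IsDefinableGroup A G) (g : G)
    {p : Set (G → ℝ)} (hp : IsGlobalType p) : IsGlobalType (translateType g p) := by
  classical
  refine ⟨⟨fun P hP => hP.1, fun F hF ε hε => ?_⟩, fun q hq hpq P hP => ⟨hq.1 hP, ?_⟩⟩
  · obtain ⟨x, hx⟩ := hp.1.2 (F.image fun P x => P (g * x)) (by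
      intro Q hQ
      obtain ⟨P, hP, rfl⟩ := Finset.mem_image.1 (Finset.mem_coe.1 hQ)
      exact (hF hP).2) ε hε
    exact ⟨g * x, fun P hP => hx _ (Finset.mem_image_of_mem _ hP)⟩
  · -- The translate of `q` back by `g⁻¹` is consistent and contains `p`.
    refine hp.2 (y := {P | P ∈ Pred G (allParams U) ∧ (fun x => P (g⁻¹ * x)) ∈ q})
      ⟨fun P hP => hP.1, fun F hF ε hε => ?_⟩ (fun P hP => ?_) ?_
    · obtain ⟨x, hx⟩ := hq.2 (F.image fun P x => P (g⁻¹ * x)) (by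
        intro Q hQ
        obtain ⟨P, hP, rfl⟩ := Finset.mem_image.1 (Finset.mem_coe.1 hQ)
        exact (hF hP).2) ε hε
      exact ⟨g⁻¹ * x, fun P hP => hx _ (Finset.mem_image_of_mem _ hP)⟩
    · refine ⟨hp.1.1 hP, hpq ⟨hG.translate_mem_pred g⁻¹ (hp.1.1 hP), ?_⟩⟩
      simpa only [inv_mul_cancel_left] using hP
    · refine ⟨hG.translate_mem_pred g (hq.1 hP), ?_⟩
      simpa only [mul_inv_cancel_left] using hP

theorem IsWide.translateType [Group G] {I p : Set (G → ℝ)} (hI : IsTranslationInvariant I)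
    (hw : IsWide I p) (g : G) : IsWide I (translateType g p) := by
  refine Set.eq_empty_of_forall_notMem fun P ⟨hP, hPI⟩ => ?_
  have h := hI g⁻¹ P hPI
  have h' : translate g⁻¹ P = fun x => P (g * x) := by
    funext x
    rw [translate, inv_inv]
  rw [h'] at h
  exact Set.eq_empty_iff_forall_notMem.1 hw _ ⟨hP.2, h⟩

/-! ### Wide types do not fork -/

/-- A connective applied to two instances of a definable predicate is an instance, at the pair of
parameter tuples, of a definable predicate. -/
theorem IsDefPred.exists_pair {β : Type w} {τ : β → L.Sorts}
    {R : (∀ z, U (Sum.elim σ τ z)) → ℝ} (hR : IsDefPred A (Sum.elim σ τ) R) {c : ℝ → ℝ → ℝ}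
    (hc : Continuous fun y : ℝ × ℝ => c y.1 y.2) :
    ∃ R' : (∀ z, U (Sum.elim σ (fun z : Fin 2 × β => τ z.2) z)) → ℝ,
      IsDefPred A (Sum.elim σ fun z : Fin 2 × β => τ z.2) R' ∧
      ∀ x a a', R' (glue x (pairTuple a a')) = c (R (glue x a)) (R (glue x a')) := by
  let τ' : Fin 2 × β → L.Sorts := fun z => τ z.2
  let f : Fin 2 → ∀ z, Term L (Sum.elim (Sum.elim σ τ') (Sigma.fst : (Σ s, ↥(A s)) → L.Sorts)) []
      (Sum.elim σ τ z) := fun t z => match z with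
    | .inl i => varTerm A (Sum.elim σ τ') (.inl i)
    | .inr j => varTerm A (Sum.elim σ τ') (.inr (t, j))
  refine ⟨_, (IsDefPred.subst hR (fun _ => subset_rfl) (f 0)).comp₂
    (IsDefPred.subst hR (fun _ => subset_rfl) (f 1)) hc, fun x a a' => ?_⟩
  refine congrArg₂ c (congrArg R ?_) (congrArg R ?_)
  · funext z
    rcases z with i | j <;> rfl
  · funext z
    rcases z with i | j <;> rfl

theorem PosPred.add {P Q : G → ℝ} (hP : P ∈ PosPred G) (hQ : Q ∈ PosPred G) :
    P + Q ∈ PosPred G :=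
  ⟨Pred.add hP.1 hQ.1, fun x => add_nonneg (hP.2 x) (hQ.2 x)⟩

/-- The `S₁`-property for sums of `2 ^ k` members of an indiscernible sequence, by induction on `k`:
the sequence of the sums of consecutive pairs is indiscernible, too. -/
theorem IsS1Ideal.inst_mem_of_sum_mem {I : Set (G → ℝ)} (hI : IsS1Ideal A I) (k : ℕ) :
    ∀ {β : Type u} {τ : β → L.Sorts} {b : ℕ → ∀ j, U (τ j)} {R : (∀ z, U (Sum.elim σ τ z)) → ℝ},
      Indiscernible A b → IsDefPred A (Sum.elim σ τ) R →
      (∀ i, (inst R (b i) : G → ℝ) ∈ PosPred G) →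
      (fun x => ∑ i ∈ Finset.range (2 ^ k), inst R (b i) x) ∈ I → inst R (b 0) ∈ I := by
  induction k with
  | zero =>
    intro β τ b R _ _ _ h
    simpa using h
  | succ k ih =>
    intro β τ b R hb hR hpos h
    obtain ⟨R', hR', hval⟩ := hR.exists_pair (c := fun a b => a + b) (by fun_prop)
    have hinst : ∀ a a', (inst R' (pairTuple a a') : G → ℝ) = inst R a + inst R a' :=
      fun a a' => funext fun x => hval x.1 a a'
    have h01 : (inst R (b 0) + inst R (b 1) : G → ℝ) ∈ I := by
      rw [← hinst]
      refine ih (b := fun i => pairTuple (b (2 * i)) (b (2 * i + 1))) hb.pairs hR' (fun i => ?_) ?_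
      · rw [hinst]
        exact PosPred.add (hpos _) (hpos _)
      · convert h using 2 with x
        simp only [hinst, Pi.add_apply]
        generalize inst R = r
        have : ∀ (r : ℕ → ℝ) (m : ℕ), ∑ i ∈ Finset.range m, (r (2 * i) + r (2 * i + 1)) =
            ∑ i ∈ Finset.range (2 * m), r i := by
          intro r m
          induction m with
          | zero => simp
          | succ m ihm =>
            rw [Finset.sum_range_succ, ihm, mul_add, mul_one, Finset.sum_range_succ,
              Finset.sum_range_succ, add_assoc]
        rw [pow_succ, mul_comm (2 ^ k) 2]
        exact this (fun i => r (b i) x) _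
    have hlt : ∀ i j, i < j → (inst R (b i) + inst R (b j) : G → ℝ) ∈ I := by
      intro i j hij
      rw [← hinst] at h01 ⊢
      exact hI.invariant _ _ _ _ (hb.sameType_pair zero_lt_one hij) R' hR' h01
    refine hI.s1 β τ b R hb hR hpos (fun i j hij => ?_) 0
    rcases hij.lt_or_gt with h' | h'
    · exact hlt i j h'
    · rw [add_comm]
      exact hlt j i h'

/-- A wide type does not divide: if it did, then by compactness a sum of finitely many positive
predicates from an indiscernible sequence, one of them in the type, would be bounded away from `0`,
hence in the ideal. -/
theorem IsS1Ideal.not_divides {κ : Cardinal.{u}} (hκ : ℵ₀ < κ) (hsat : IsSaturated U κ)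
    (hA : #(Σ s, ↥(A s)) < κ) [Group G] (hG : IsDefinableGroup A G) {I : Set (G → ℝ)}
    (hI : IsS1Ideal A I) {p : Set (G → ℝ)} (hp : IsCompleteType D p) (hw : IsWide I p) :
    ¬ Divides κ A p := by
  rintro ⟨β, τ, b, Φ, hβ, hb, hΦ, hΦp, hns⟩
  obtain ⟨F, hF, N, ε, hε, hle⟩ := hG.exists_pos_le_sum hκ hsat hA hβ b hΦ hns
  let R : (∀ z, U (Sum.elim σ τ z)) → ℝ := fun z => ∑ S ∈ F, |S z|
  have hR : IsDefPred A (Sum.elim σ τ) R :=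
    IsDefPred.sum F fun S hS => (hΦ S (hF hS)).comp₁ continuous_abs
  have hR0 : ∀ z, 0 ≤ R z := fun z => Finset.sum_nonneg fun _ _ => abs_nonneg _
  have hpos : ∀ i, (inst R (b i) : G → ℝ) ∈ PosPred G := fun i =>
    ⟨inst_mem_pred hR _, fun x => hR0 _⟩
  have hsum : (fun x => ∑ i ∈ Finset.range (2 ^ N), inst R (b i) x) ∈ I := by
    refine hI.ideal.up _ (hI.ideal.const ε hε) _
      ⟨Pred.sum _ fun i _ => (hpos i).1, fun x => Finset.sum_nonneg fun i _ => hR0 _⟩ fun x => ?_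
    refine (hle x).trans (Finset.sum_le_sum_of_subset_of_nonneg
      (f := fun i => inst R (b i) x) ?_ fun i _ _ => hR0 _)
    exact Finset.range_mono Nat.lt_two_pow_self.le
  refine Set.eq_empty_iff_forall_notMem.1 hw _
    ⟨?_, hI.inst_mem_of_sum_mem N hb hR hpos hsum⟩
  exact hp.sum_abs_mem F (P := fun S => inst S (b 0)) fun S hS => hΦp S (hF hS)

theorem IsS1Ideal.not_forks {κ : Cardinal.{u}} (hκ : ℵ₀ < κ) (hsat : IsSaturated U κ)
    (hA : #(Σ s, ↥(A s)) < κ) [Group G] (hG : IsDefinableGroup A G) {I : Set (G → ℝ)}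
    (hI : IsS1Ideal A I) {p : Set (G → ℝ)} (hp : IsGlobalType p) (hw : IsWide I p) :
    ¬ Forks κ A p := by
  rintro ⟨D, -, hpD, h⟩
  -- A global type is its own extension to a complete type over `D`.
  have hpc : IsCompleteType D p := ⟨⟨hpD, hp.1.2⟩, fun q hq hpq =>
    hp.2 ⟨hq.1.trans (Pred.mono fun s => Set.subset_univ _), hq.2⟩ hpq⟩
  exact hI.not_divides hκ hsat hA hG hpc hw (h p hpc subset_rfl)

theorem IsS1Ideal.isFGeneric {κ : Cardinal.{u}} (hκ : ℵ₀ < κ) (hsat : IsSaturated U κ)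
    (hA : IsSmallModel κ A) [Group G] (hG : IsDefinableGroup A G) {I : Set (G → ℝ)}
    (hI : IsS1Ideal A I) (hIG : IsTranslationInvariant I) {p : Set (G → ℝ)} (hp : IsGlobalType p)
    (hw : IsWide I p) : IsFGeneric κ p :=
  ⟨A, hA, hG, fun g => hI.not_forks hκ hsat hA.2 hG (hG.translateType_isGlobalType g hp)
    (hw.translateType hIG g)⟩

end Ideals

section Means

variable {L : MetricLanguage.{u}} {U : L.Sorts → Type u} [∀ s, MetricSpace (U s)]
  [MetricStructure L U] {A : ∀ s, Set (U s)} {n : ℕ} {σ : Fin n → L.Sorts}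
  {G : Set (∀ i, U (σ i))} {m : (G → ℝ) → ℝ}

/-! ### Means -/

theorem IsMean.const (hm : IsMean m) (c : ℝ) : m (fun _ => c) = c := by
  have h := hm.smul c (fun _ => 1) (Pred.const 1)
  rw [hm.one, mul_one] at h
  refine Eq.trans (congrArg m ?_) h
  funext x
  exact (mul_one c).symm

theorem IsMean.sub (hm : IsMean m) {P Q : G → ℝ} (hP : P ∈ Pred G (allParams U))
    (hQ : Q ∈ Pred G (allParams U)) : m (P - Q) = m P - m Q := by
  have hPQ : P - Q ∈ Pred G (allParams U) := Pred.comp₂ hP hQ (c := fun a b => a - b) (by fun_prop)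
  have h := hm.add (P - Q) hPQ Q hQ
  rw [sub_add_cancel] at h
  linarith

theorem IsMean.mono (hm : IsMean m) {P Q : G → ℝ} (hP : P ∈ Pred G (allParams U))
    (hQ : Q ∈ Pred G (allParams U)) (h : ∀ x, P x ≤ Q x) : m P ≤ m Q := by
  have hQP : Q - P ∈ PosPred G :=
    ⟨Pred.comp₂ hQ hP (c := fun a b => a - b) (by fun_prop), fun x => sub_nonneg.2 (h x)⟩
  have h₁ := hm.nonneg _ hQP
  rw [hm.sub hQ hP] at h₁
  linarith

theorem IsMean.sum (hm : IsMean m) {ι : Type*} (s : Finset ι) {P : ι → G → ℝ}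
    (hP : ∀ i ∈ s, P i ∈ Pred G (allParams U)) :
    m (fun x => ∑ i ∈ s, P i x) = ∑ i ∈ s, m (P i) := by
  classical
  induction s using Finset.induction_on with
  | empty => simpa using hm.const 0
  | insert i s hi ih =>
    have hs : ∀ j ∈ s, P j ∈ Pred G (allParams U) := fun j hj => hP j (Finset.mem_insert_of_mem hj)
    simp only [Finset.sum_insert hi]
    rw [← ih hs]
    exact hm.add _ (hP i (Finset.mem_insert_self i s)) _ (Pred.sum s hs)

/-- Second moment estimate: if infinitely many predicates with values in `[0, 1]` have mean `q` and
the products of any two of them have mean at most `η`, then `q ^ 2 ≤ η`. -/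
theorem IsMean.sq_le_of_mul_le (hm : IsMean m) {Q : ℕ → G → ℝ}
    (hQ : ∀ i, Q i ∈ Pred G (allParams U)) (h0 : ∀ i x, 0 ≤ Q i x) (h1 : ∀ i x, Q i x ≤ 1)
    {q η : ℝ} (hq : ∀ i, m (Q i) = q) (hη : ∀ i j, i ≠ j → m (Q i * Q j) ≤ η) : q ^ 2 ≤ η := by
  have hη0 : 0 ≤ η := (hm.nonneg _ ⟨Pred.mul (hQ 0) (hQ 1),
    fun x => mul_nonneg (h0 0 x) (h0 1 x)⟩).trans (hη 0 1 zero_ne_one)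
  have hq0 : 0 ≤ q := (hm.nonneg _ ⟨hQ 0, h0 0⟩).trans_eq (hq 0)
  have hN : ∀ N : ℕ, (N * q) ^ 2 ≤ N ^ 2 * η + N * q := by
    intro N
    let S : G → ℝ := fun x => ∑ i ∈ Finset.range N, Q i x
    have hS : S ∈ Pred G (allParams U) := Pred.sum _ fun i _ => hQ i
    have hmS : m S = N * q := by
      rw [hm.sum _ fun i _ => hQ i]
      simp [hq]
    have hmSS : m (S * S) ≤ N ^ 2 * η + N * q := by
      have hexp : S * S = fun x => ∑ i ∈ Finset.range N, ∑ j ∈ Finset.range N, (Q i * Q j) x := by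
        funext x
        exact Finset.sum_mul_sum _ _ _ _
      rw [hexp, hm.sum _ fun i _ => Pred.sum _ fun j _ => Pred.mul (hQ i) (hQ j)]
      have hij : ∀ i j, m (Q i * Q j) ≤ η + if i = j then q else 0 := by
        intro i j
        split_ifs with h
        · subst h
          have := hm.mono (Pred.mul (hQ i) (hQ i)) (hQ i)
            fun x => mul_le_of_le_one_left (h0 i x) (h1 i x)
          rw [hq] at this
          linarith
        · rw [add_zero]
          exact hη i j h
      have hi : ∀ i ∈ Finset.range N, m (fun x => ∑ j ∈ Finset.range N, (Q i * Q j) x) ≤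
          N * η + q := by
        intro i hi
        rw [hm.sum _ fun j _ => Pred.mul (hQ i) (hQ j)]
        refine (Finset.sum_le_sum fun j _ => hij i j).trans ?_
        rw [Finset.sum_add_distrib, Finset.sum_ite_eq, if_pos hi]
        simp
      refine (Finset.sum_le_card_nsmul _ _ _ hi).trans (le_of_eq ?_)
      rw [Finset.card_range, nsmul_eq_mul]
      ring
    -- The mean of `(S - N q) ^ 2` is nonnegative.
    have hvar : 0 ≤ m ((S * S - (2 * (N * q)) • S) + fun _ => (N * q) ^ 2) := by
      refine hm.nonneg _ ⟨Pred.comp₁ hS (c := fun s => (s * s - 2 * (N * q) * s) + (N * q) ^ 2)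
        (by fun_prop), fun x => ?_⟩
      change 0 ≤ (S x * S x - 2 * (N * q) * S x) + (N * q) ^ 2
      nlinarith [sq_nonneg (S x - N * q)]
    have hsm : (2 * (N * q)) • S ∈ Pred G (allParams U) :=
      Pred.comp₁ hS (c := fun s => 2 * (N * q) * s) (by fun_prop)
    have hsub : S * S - (2 * (N * q)) • S ∈ Pred G (allParams U) :=
      Pred.comp₁ hS (c := fun s => s * s - 2 * (N * q) * s) (by fun_prop)
    rw [hm.add _ hsub _ (Pred.const _), hm.const, hm.sub (Pred.mul hS hS) hsm, hm.smul _ _ hS,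
      hmS] at hvar
    linarith
  by_contra! hlt
  obtain ⟨N, hNlt⟩ := exists_nat_gt (q / (q ^ 2 - η))
  rw [div_lt_iff₀ (sub_pos.2 hlt)] at hNlt
  have hNpos : (0 : ℝ) < N := by
    by_contra! h
    nlinarith [sub_pos.2 hlt]
  nlinarith [hN N, mul_lt_mul_of_pos_left hNlt hNpos]

/-! ### Small predicates form an `S₁`-ideal -/

theorem Pred.min_mul_one {P : G → ℝ} (hP : P ∈ Pred G A) (c : ℝ) :
    (fun x => min (c * P x) 1) ∈ Pred G A :=
  Pred.comp₁ hP (c := fun r => min (c * r) 1) (by fun_prop)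

theorem IsMean.min_mul_one_le (hm : IsMean m) {P : G → ℝ} (hP : P ∈ Pred G (allParams U)) (c : ℝ) :
    (m fun x => min (c * P x) 1) ≤ 1 :=
  (hm.mono (Pred.min_mul_one hP c) (Pred.const 1) fun _ => min_le_right _ _).trans_eq (hm.const 1)

theorem one_le_min_mul_add {a b : ℝ} (ha : 0 ≤ a) (hb : 0 ≤ b) :
    min a 1 + min b 1 - 1 ≤ min (a * b) 1 := by
  rcases le_total a 1 with h₁ | h₁ <;> rcases le_total b 1 with h₂ | h₂ <;>
    simp only [min_eq_left, min_eq_right, h₁, h₂] <;> refine le_min ?_ ?_ <;> nlinarith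

theorem one_sub_min_mul_le {a b : ℝ} (ha : 0 ≤ a) (hb : 0 ≤ b) :
    (1 - min a 1) * (1 - min b 1) ≤ 1 - min ((a + b) / 2) 1 := by
  rcases le_total a 1 with h₁ | h₁
  · rcases le_total b 1 with h₂ | h₂
    · rw [min_eq_left h₁, min_eq_left h₂, min_eq_left (by linarith)]
      nlinarith
    · rw [min_eq_right h₂]
      simp
  · rw [min_eq_right h₁]
    simp

theorem IsMean.isIdeal_smallPreds (hm : IsMean m) : IsIdeal (smallPreds m) where
  subset _ hP := hP.1
  up P hP Q hQ h := by
    refine ⟨hQ, tendsto_of_tendsto_of_tendsto_of_le_of_le' hP.2 tendsto_const_nhds ?_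
      (Eventually.of_forall fun c => hm.min_mul_one_le hQ.1 c)⟩
    filter_upwards [eventually_ge_atTop 0] with c hc
    exact hm.mono (Pred.min_mul_one hP.1.1 c) (Pred.min_mul_one hQ.1 c)
      fun x => min_le_min_right _ (mul_le_mul_of_nonneg_left (h x) hc)
  mul P hP Q hQ := by
    have hPQ := Pred.mul hP.1.1 hQ.1.1
    -- Scaling both factors by `√c` scales the product by `c`.
    have hlim := ((hP.2.add hQ.2).sub_const 1).comp Real.tendsto_sqrt_atTop
    rw [show (1 + 1 - 1 : ℝ) = 1 by norm_num] at hlim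
    refine ⟨⟨hPQ, fun x => mul_nonneg (hP.1.2 x) (hQ.1.2 x)⟩,
      tendsto_of_tendsto_of_tendsto_of_le_of_le' hlim tendsto_const_nhds ?_
      (Eventually.of_forall fun c => hm.min_mul_one_le hPQ c)⟩
    filter_upwards [eventually_ge_atTop 0] with c hc
    have h₁ := Pred.min_mul_one hP.1.1 (√c)
    have h₂ := Pred.min_mul_one hQ.1.1 (√c)
    have h₃ := Pred.add h₁ h₂
    have h₄ := hm.sub h₃ (Pred.const 1)
    rw [hm.add _ h₁ _ h₂, hm.const] at h₄
    refine h₄.symm.le.trans (hm.mono (Pred.comp₁ h₃ (c := fun r => r - 1) (by fun_prop))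
      (Pred.min_mul_one hPQ c) fun x => ?_)
    have := one_le_min_mul_add (mul_nonneg (Real.sqrt_nonneg c) (hP.1.2 x))
      (mul_nonneg (Real.sqrt_nonneg c) (hQ.1.2 x))
    rw [show √c * P x * (√c * Q x) = √c * √c * (P x * Q x) by ring, Real.mul_self_sqrt hc] at this
    exact this
  const r hr := by
    refine ⟨⟨Pred.const r, fun _ => hr.le⟩, tendsto_const_nhds.congr' ?_⟩
    filter_upwards [eventually_ge_atTop (1 / r)] with c hc
    rw [div_le_iff₀ hr] at hc
    simp only [min_eq_right hc, hm.const]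

theorem IsMean.isS1Ideal_smallPreds [Group G] (hm : IsMean m) (hG : IsDefinableGroup A G)
    (hinv : IsInvariantMeanOver A m) : IsS1Ideal A (smallPreds m) := by
  have htrunc : ∀ {β : Type u} {τ : β → L.Sorts} {R : (∀ z, U (Sum.elim σ τ z)) → ℝ}
      {a a' : ∀ j, U (τ j)}, IsDefPred A (Sum.elim σ τ) R → SameType A a a' → ∀ c : ℝ,
      (m fun x => min (c * inst R a x) 1) = m fun x => min (c * inst R a' x) 1 :=
    fun hR h c => hinv _ _ _ _ h (fun z => min (c * _) 1)
      (hR.comp₁ (c := fun r => min (c * r) 1) (by fun_prop))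
  refine ⟨hm.isIdeal_smallPreds, fun β τ a a' h R hR hRa => ?_, ?_⟩
  · exact ⟨hG.inst_mem_posPred hR h hRa.1, hRa.2.congr fun c => htrunc hR h c⟩
  · intro β τ b R hb hR hpos hsum
    have hpred : ∀ i, (inst R (b i) : G → ℝ) ∈ Pred G (allParams U) := fun i => (hpos i).1
    -- All pairs have the same mean as the pair `(b 0, b 1)`.
    have hpair : ∀ (c : ℝ) (i j : ℕ), i ≠ j →
        (m fun x => min (c * (inst R (b i) x + inst R (b j) x)) 1) =
          m fun x => min (c * (inst R (b 0) x + inst R (b 1) x)) 1 := by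
      intro c
      obtain ⟨R', hR', hval⟩ := hR.exists_pair (c := fun r s => min (c * (r + s)) 1) (by fun_prop)
      have hinst : ∀ a a', (fun x => min (c * (inst R a x + inst R a' x)) 1) =
          (inst R' (pairTuple a a') : G → ℝ) := fun a a' => funext fun x => (hval x.1 a a').symm
      have hlt : ∀ i j, i < j → (m fun x => min (c * (inst R (b i) x + inst R (b j) x)) 1) =
          m fun x => min (c * (inst R (b 0) x + inst R (b 1) x)) 1 := by
        intro i j hij
        rw [hinst, hinst]
        exact hinv _ _ _ _ (hb.sameType_pair hij zero_lt_one) R' hR'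
      intro i j hij
      rcases hij.lt_or_gt with h | h
      · exact hlt i j h
      · rw [← hlt j i h]
        simp only [add_comm]
    -- The left side is the square of the common mean of the predicates `1 - min (c P i) 1`.
    have hsq : ∀ c : ℝ, 0 ≤ c → (1 - m fun x => min (c * inst R (b 0) x) 1) ^ 2 ≤
        1 - m fun x => min (c / 2 * (inst R (b 0) x + inst R (b 1) x)) 1 := by
      intro c hc
      have hT : ∀ i, (fun x => min (c * inst R (b i) x) 1) ∈ Pred G (allParams U) := fun i =>
        Pred.min_mul_one (hpred i) c
      have hQ : ∀ i, (fun x => 1 - min (c * inst R (b i) x) 1) ∈ Pred G (allParams U) := fun i =>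
        Pred.comp₁ (hT i) (c := fun r => 1 - r) (by fun_prop)
      refine hm.sq_le_of_mul_le hQ (fun i x => sub_nonneg.2 (min_le_right _ _))
        (fun i x => sub_le_self _ (le_min (mul_nonneg hc ((hpos i).2 x)) zero_le_one))
        (fun i => ?_) fun i j hij => ?_
      · rw [← htrunc hR (hb.sameType_single i 0) c]
        exact (hm.sub (Pred.const 1) (hT i)).trans (by rw [hm.const])
      · have hTij : (fun x => min (c / 2 * (inst R (b i) x + inst R (b j) x)) 1) ∈
            Pred G (allParams U) := Pred.min_mul_one (Pred.add (hpred i) (hpred j)) (c / 2)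
        have h₁ := hm.sub (Pred.const 1) hTij
        rw [hm.const, hpair _ i j hij] at h₁
        rw [← h₁]
        refine hm.mono (Pred.mul (hQ i) (hQ j))
          (Pred.comp₁ hTij (c := fun r => 1 - r) (by fun_prop)) fun x => ?_
        have := one_sub_min_mul_le (mul_nonneg hc ((hpos i).2 x)) (mul_nonneg hc ((hpos j).2 x))
        rw [show (c * inst R (b i) x + c * inst R (b j) x) / 2 =
          c / 2 * (inst R (b i) x + inst R (b j) x) by ring] at this
        exact this
    have hlim : Tendsto (fun c : ℝ => m fun x => min (c * inst R (b 0) x) 1) atTop (𝓝 1) := by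
      have h₁ := ((hsum 0 1 zero_ne_one).2.comp
        (tendsto_id.atTop_div_const (zero_lt_two (α := ℝ)))).const_sub 1
      have h₂ := (Real.continuous_sqrt.tendsto _).comp h₁
      rw [sub_self, Real.sqrt_zero] at h₂
      have h₃ := squeeze_zero_norm' (f := fun c : ℝ => 1 - m fun x => min (c * inst R (b 0) x) 1)
        (by
          filter_upwards [eventually_ge_atTop 0] with c hc
          exact Real.abs_le_sqrt (hsq c hc)) h₂
      simpa using h₃.const_sub 1
    exact fun i => ⟨hpos i, hlim.congr fun c => htrunc hR (hb.sameType_single 0 i) c⟩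

theorem IsGroupInvariantMean.isTranslationInvariant_smallPreds [Group G]
    (hm : IsGroupInvariantMean m)
    (hG : IsDefinableGroup A G) : IsTranslationInvariant (smallPreds m) :=
  fun g _ hP => ⟨⟨hG.translate_mem_pred g⁻¹ hP.1.1, fun _ => hP.1.2 _⟩,
    hP.2.congr fun c => (hm g _ (Pred.min_mul_one hP.1.1 c)).symm⟩

end Means

end ContLogic

theorem mainTheorem5 (L : MetricLanguage.{u}) (U : L.Sorts → Type u) [∀ s, MetricSpace (U s)]
    [MetricStructure L U] (κ : Cardinal.{u}) (hκ : ℵ₀ < κ) (hsat : IsSaturated U κ)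
    {n : ℕ} {σ : Fin n → L.Sorts} (G : Set (∀ i, U (σ i))) [Group G]
    (M : ∀ s, Set (U s)) (hM : IsSmallModel κ M) (hG : IsDefinableGroup M G) :
    (∀ I : Set (G → ℝ), IsS1Ideal M I → IsTranslationInvariant I →
      ∀ p : Set (G → ℝ), IsGlobalType p → IsWide I p → IsFGeneric κ p) ∧
    (∀ m : (G → ℝ) → ℝ, IsMean m → IsGroupInvariantMean m → IsInvariantMeanOver M m →
      ∀ p : Set (G → ℝ), IsGlobalType p → IsWide (smallPreds m) p → IsFGeneric κ p) :=
  ⟨fun _ hI hIG _ hp hw => hI.isFGeneric hκ hsat hM hG hIG hp hw,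
    fun _ hm hmG hmM _ hp hw => (hm.isS1Ideal_smallPreds hG hmM).isFGeneric hκ hsat hM hG
      (hmG.isTranslationInvariant_smallPreds hG) hp hw⟩
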